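/- Let $\mathbb{T}^2=\mathbb{R}^2/\mathbb{Z}^2$ be the flat torus, write points of $(0,1)\times\mathbb{T}^2$ as $(z,x')$ with $x'=(x_2,x_3)$, and let $\int$ denote integration over $(0,1)\times\mathbb{T}^2$ with respect to $dz\,dx'$. For every $M>0$ there exist $\delta_M>0$ and $\varepsilon_M\in(0,1)$ such that for all $0<\delta<\delta_M$ and $0<\varepsilon<\varepsilon_M$ the following holds. For every real-valued $W\in L^2((0,1)\times\mathbb{T}^2)$ with weak derivative $\partial_zW$ satisfying $\sqrt{z(1-z)}\,\partial_zW\in L^2((0,1)\times\mathbb{T}^2)$, if $$\|W\|_{L^\infty}\le\frac1\varepsilon\qquad\text{and}\qquad\int W^2\,dz\,dx'\le M,$$ then $R_{\varepsilon,\delta}(W)\le 0$, where $$\begin{aligned}R_{\varepsilon,\delta}(W)={}&-\frac1\delta\Big(\int W^2\,dz\,dx'+2\int W\,dz\,dx'\Big)^2+(1+\delta)\int W^2\,dz\,dx'\\&+\frac23\int W^3\,dz\,dx'+\delta\int|W|^3\,dz\,dx'\\&-(1-\delta)\int z(1-z)|\partial_zW|^2\,dz\,dx'-\frac{1-\delta}{\varepsilon^{3/2}}\sum_{i=2}^3\int|\partial_{x_i}W|^2\,dz\,dx'.\end{aligned}$$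 Derivatives are taken in the sense of distributions on $(0,1)\times\mathbb{T}^2$, and $\int|\partial_{x_i}W|^2\,dz\,dx'=+\infty$ if $\partial_{x_i}W$ is not in $L^2$ (so that then $R_{\varepsilon,\delta}(W)=-\infty$ when $\delta<1$). -/

import Mathlib

open MeasureTheory Set
open scoped ENNReal ContDiff

noncomputable section

namespace StripPoincare

/-- `ℝ × 𝕋²` with `𝕋² = ℝ² / ℤ²` the flat torus of total mass one; a point is `(z, x₂, x₃)`. -/
abbrev Cyl : Type := ℝ × UnitAddCircle × UnitAddCircle

/-- The open domain `(0,1) × 𝕋²`. Functions on it are represented by functions on `Cyl`, whose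
values outside the domain are never used. -/
def Omega : Set Cyl := Ioo (0 : ℝ) 1 ×ˢ univ

/-- The translation by `s` in the `i`-th coordinate direction: `0` is the direction `z`, and
`1`, `2` are the transversal directions `x₂`, `x₃`. -/
def shift : Fin 3 → ℝ → Cyl :=
  ![fun s => (s, 0, 0), fun s => (0, (s : UnitAddCircle), 0), fun s => (0, 0, (s : UnitAddCircle))]

/-- The classical partial derivative `∂ᵢ φ`. -/
def partialD (i : Fin 3) (φ : Cyl → ℝ) (p : Cyl) : ℝ :=
  deriv (fun s : ℝ => φ (p + shift i s)) 0

/-- Test functions, that is `C_c^∞((0,1) × 𝕋²)`. Smoothness on the torus is smoothness of the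
periodic lift to `ℝ³`. -/
structure IsTest (φ : Cyl → ℝ) : Prop where
  smooth : ContDiff ℝ ∞
    (fun y : ℝ × ℝ × ℝ => φ (y.1, (y.2.1 : UnitAddCircle), (y.2.2 : UnitAddCircle)))
  compact : HasCompactSupport φ
  support : tsupport φ ⊆ Omega

/-- `g` is the weak (distributional) derivative `∂ᵢ W` on `(0,1) × 𝕋²`. -/
structure IsWeakDeriv (i : Fin 3) (W g : Cyl → ℝ) : Prop where
  locInt : LocallyIntegrableOn W Omega
  locInt_deriv : LocallyIntegrableOn g Omega
  integral_eq : ∀ φ : Cyl → ℝ, IsTest φ →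
    ∫ p in Omega, W p * partialD i φ p = - ∫ p in Omega, g p * φ p

/-- `∫ z (1 - z) |∂_z W|²`. The weak derivative is unique almost everywhere, so the infimum is over
a single value; it is `∞` if there is no weak derivative. -/
def zEnergy (W : Cyl → ℝ) : ℝ≥0∞ :=
  ⨅ (g : Cyl → ℝ) (_ : IsWeakDeriv 0 W g),
    ∫⁻ p in Omega, ENNReal.ofReal (p.1 * (1 - p.1) * g p ^ 2)

/-- `∫ |∂ᵢ W|²`, with value `∞` if the distribution `∂ᵢ W` is not a square integrable function. -/
def energy (i : Fin 3) (W : Cyl → ℝ) : ℝ≥0∞ :=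
  ⨅ (g : Cyl → ℝ) (_ : IsWeakDeriv i W g), ∫⁻ p in Omega, ENNReal.ofReal (g p ^ 2)

/-- The functional `R_{ε,δ}(W)`, with value `-∞` if the transversal energy is infinite. -/
def R (ε δ : ℝ) (W : Cyl → ℝ) : EReal :=
  ((-(1 / δ) * ((∫ p in Omega, W p ^ 2) + 2 * ∫ p in Omega, W p) ^ 2
      + (1 + δ) * (∫ p in Omega, W p ^ 2)
      + 2 / 3 * (∫ p in Omega, W p ^ 3)
      + δ * (∫ p in Omega, |W p| ^ 3) : ℝ) : EReal)
    - ((1 - δ : ℝ) : EReal) * (zEnergy W : EReal)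
    - (((1 - δ) / ε ^ (3 / 2 : ℝ) : ℝ) : EReal) * ((energy 1 W + energy 2 W : ℝ≥0∞) : EReal)

end StripPoincare

end

/-!
Put `f = 1 + W` and cut the cylinder into vertical slices `{(z, x') : 0 < z < 1}`. Any weak
derivative `g` of `W` in the direction `z` makes almost every slice of `W` a primitive of the slice
of `g`, so that with `D = ∫ z (1 - z) g² dz` one-dimensional estimates are available on the slices.

* On a slice with mean `m` and `L²` norm `h` of `f`, `∫ f³ ≤ h³ + (7/5) h D - (m₋)³`
  (`third_moment_le`). This rests on the sharp Poincaré inequality `Var f ≤ D / 2`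
  (`IsWeightedPrimitive.variance_le`) and on the pointwise bound
  `(f - m)² ≤ D (-1 - log z - log (1 - z))` (`IsWeightedPrimitive.ae_sq_sub_mean_le`).
  Since `(2/3) (7/5) < 1`, on the slices with `h` close to `1` the energy in `z` absorbs the cubic
  term.
* On the remaining slices only `|W| ≤ 1/ε` is used, at the price of a factor `1/ε` in front of
  `∫ h²`. There `h` is far from its average over the slices, so this is at most `1/ε` times the
  variance of `h` in `x'`. Two slices of `W` are at least as far apart in `L²` as their values of `h`,
  so this variance is at most the transversal energy (`lintegral_sq_sub_translate_le`,
  `variance_le_of_translates`), whose coefficient `ε^(-3/2)` is much larger.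

If `E = ∫ W² + 2 ∫ W = ∫ f² - 1` is not small, the term `-E²/δ` dominates a constant depending on
`M` only, and a crude slice estimate suffices (`far_constraint_bound`). If `E` is small, `h` is close
to `1` on average, and the terms of order `δ` are absorbed by the energies unless `f` is close to
`-1`; there the term `(m₋)³` gives a strict gain (`near_constraint_bound`).

The energies are infima over all weak derivatives; the estimate is proved for each choice of weak
derivatives, which makes their uniqueness unnecessary.
-/

open MeasureTheory Set
open scoped ENNReal ContDiff

noncomputable section

namespace StripPoincare

/-! ### The covering by `ℝ³` -/

/-- The covering map `ℝ³ → ℝ × 𝕋²`. -/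
def cover (y : ℝ × ℝ × ℝ) : Cyl := (y.1, (y.2.1 : UnitAddCircle), (y.2.2 : UnitAddCircle))

/-- The standard basis of `ℝ³`, in the order of `shift`. -/
def stdVec : Fin 3 → ℝ × ℝ × ℝ := ![(1, 0, 0), (0, 1, 0), (0, 0, 1)]

lemma cover_add_smul (i : Fin 3) (y : ℝ × ℝ × ℝ) (t : ℝ) :
    cover (y + t • stdVec i) = cover y + shift i t := by
  fin_cases i <;> simp [cover, stdVec, shift]

lemma shift_add (i : Fin 3) (s t : ℝ) : shift i (s + t) = shift i s + shift i t := by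
  fin_cases i <;> simp [shift]

lemma shift_zero (i : Fin 3) : shift i 0 = 0 := by
  fin_cases i <;> simp [shift]

lemma shift_neg (i : Fin 3) (s : ℝ) : shift i (-s) = -shift i s := by
  rw [eq_neg_iff_add_eq_zero, ← shift_add, neg_add_cancel, shift_zero]

lemma continuous_shift (i : Fin 3) : Continuous (shift i) := by
  have h : Continuous (fun s : ℝ => (s : UnitAddCircle)) := AddCircle.continuous_mk' 1
  fin_cases i
  · exact continuous_id.prodMk continuous_const
  · exact continuous_const.prodMk (h.prodMk continuous_const)
  · exact continuous_const.prodMk (continuous_const.prodMk h)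

lemma isOpenQuotientMap_cover : IsOpenQuotientMap cover := by
  have h : IsOpenQuotientMap (fun s : ℝ => (s : UnitAddCircle)) :=
    QuotientAddGroup.isOpenQuotientMap_mk
  exact IsOpenQuotientMap.id.prodMap (h.prodMap h)

lemma continuous_cover : Continuous cover := isOpenQuotientMap_cover.continuous

lemma surjective_cover : Function.Surjective cover := isOpenQuotientMap_cover.surjective

lemma isOpen_Omega : IsOpen Omega := isOpen_Ioo.prod isOpen_univ

/-! ### Test functions and the fundamental lemma of the calculus of variations -/

lemma IsTest.contDiff_cover {φ : Cyl → ℝ} (hφ : IsTest φ) : ContDiff ℝ ∞ (φ ∘ cover) := hφ.smooth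

lemma IsTest.continuous {φ : Cyl → ℝ} (hφ : IsTest φ) : Continuous φ :=
  isOpenQuotientMap_cover.isQuotientMap.continuous_iff.2 hφ.contDiff_cover.continuous

lemma IsTest.hasDerivAt_cover {φ : Cyl → ℝ} (hφ : IsTest φ) (i : Fin 3) (y : ℝ × ℝ × ℝ) (t : ℝ) :
    HasDerivAt (fun s => φ (cover y + shift i s))
      (fderiv ℝ (φ ∘ cover) (y + t • stdVec i) (stdVec i)) t := by
  have h1 : HasFDerivAt (φ ∘ cover) (fderiv ℝ (φ ∘ cover) (y + t • stdVec i))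
      (y + t • stdVec i) :=
    (hφ.contDiff_cover.differentiable (by simp) _).hasFDerivAt
  have h2 : HasDerivAt (fun s : ℝ => y + s • stdVec i) (stdVec i) t := by
    simpa using ((hasDerivAt_id t).smul_const (stdVec i)).const_add y
  refine (h1.comp_hasDerivAt t h2).congr_of_eventuallyEq (Filter.Eventually.of_forall fun s => ?_)
  simp [cover_add_smul]

lemma IsTest.partialD_cover {φ : Cyl → ℝ} (hφ : IsTest φ) (i : Fin 3) (y : ℝ × ℝ × ℝ) :
    partialD i φ (cover y) = fderiv ℝ (φ ∘ cover) y (stdVec i) := by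
  have h := (hφ.hasDerivAt_cover i y 0).deriv
  rwa [zero_smul, add_zero] at h

lemma IsTest.hasDerivAt_shift {φ : Cyl → ℝ} (hφ : IsTest φ) (i : Fin 3) (p : Cyl) (t : ℝ) :
    HasDerivAt (fun s => φ (p + shift i s)) (partialD i φ (p + shift i t)) t := by
  obtain ⟨y, rfl⟩ := surjective_cover p
  rw [← cover_add_smul, hφ.partialD_cover]
  exact hφ.hasDerivAt_cover i y t

lemma IsTest.continuous_partialD {φ : Cyl → ℝ} (hφ : IsTest φ) (i : Fin 3) :
    Continuous (partialD i φ) := by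
  refine isOpenQuotientMap_cover.isQuotientMap.continuous_iff.2 ?_
  have : partialD i φ ∘ cover = fun y => fderiv ℝ (φ ∘ cover) y (stdVec i) := by
    funext y; exact hφ.partialD_cover i y
  rw [this]
  exact (hφ.contDiff_cover.continuous_fderiv (by simp)).clm_apply continuous_const

lemma IsTest.partialD_eq_zero {φ : Cyl → ℝ} (i : Fin 3) {p : Cyl} (hp : p ∉ tsupport φ) :
    partialD i φ p = 0 := by
  have h1 : ∀ᶠ q in nhds p, φ q = 0 := notMem_tsupport_iff_eventuallyEq.1 hp
  have h2 : Filter.Tendsto (fun s => p + shift i s) (nhds 0) (nhds p) := by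
    have : Continuous fun s => p + shift i s := continuous_const.add (continuous_shift i)
    simpa [shift_zero] using this.tendsto 0
  have h3 : (fun s => φ (p + shift i s)) =ᶠ[nhds 0] fun _ => 0 := h2.eventually h1
  rw [partialD, h3.deriv_eq]; simp

lemma IsTest.exists_bound {φ : Cyl → ℝ} (hφ : IsTest φ) : ∃ C, ∀ p, ‖φ p‖ ≤ C :=
  hφ.compact.exists_bound_of_continuous hφ.continuous

lemma IsTest.exists_bound_partialD {φ : Cyl → ℝ} (hφ : IsTest φ) (i : Fin 3) :
    ∃ C, ∀ p, ‖partialD i φ p‖ ≤ C :=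
  HasCompactSupport.exists_bound_of_continuous
    (HasCompactSupport.intro hφ.compact fun _ h => IsTest.partialD_eq_zero i h)
    (hφ.continuous_partialD i)

lemma tsupport_comp_sub (φ : Cyl → ℝ) (a : Cyl) :
    tsupport (fun q => φ (q - a)) = (fun q => q - a) ⁻¹' tsupport φ :=
  tsupport_comp_eq_preimage φ (Homeomorph.subRight a)

lemma IsTest.comp_sub_shift {φ : Cyl → ℝ} (hφ : IsTest φ) (i : Fin 3) (t : ℝ)
    (h : ∀ p ∈ tsupport φ, p + shift i t ∈ Omega) : IsTest (fun q => φ (q - shift i t)) where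
  smooth := by
    have : (fun y : ℝ × ℝ × ℝ => φ (cover y - shift i t)) =
        (φ ∘ cover) ∘ (fun y => y + (-t) • stdVec i) := by
      funext y
      simp only [Function.comp_apply, cover_add_smul, shift_neg, sub_eq_add_neg]
    change ContDiff ℝ ∞ (fun y : ℝ × ℝ × ℝ => φ (cover y - shift i t))
    rw [this]
    exact hφ.contDiff_cover.comp (by fun_prop)
  compact := hφ.compact.comp_homeomorph (Homeomorph.subRight (shift i t))
  support := by
    rw [tsupport_comp_sub]
    intro q hq
    simpa using h _ hq

lemma partialD_comp_sub (i : Fin 3) (φ : Cyl → ℝ) (a p : Cyl) :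
    partialD i (fun q => φ (q - a)) p = partialD i φ (p - a) := by
  simp only [partialD, add_sub_right_comm]

/-- The function on `ℝ × 𝕋²` whose lift is the periodic extension of the restriction of `ψ` to the
cell `ℝ × [0,1)²`. -/
def periodize (ψ : ℝ × ℝ × ℝ → ℝ) (p : Cyl) : ℝ :=
  ψ (p.1, AddCircle.equivIco 1 0 p.2.1, AddCircle.equivIco 1 0 p.2.2)

lemma periodize_cover (ψ : ℝ × ℝ × ℝ → ℝ) (y : ℝ × ℝ × ℝ) :
    periodize ψ (cover y) = ψ (y.1, Int.fract y.2.1, Int.fract y.2.2) := by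
  simp [periodize, cover, AddCircle.coe_equivIco_mk_apply]

lemma cover_fract (y : ℝ × ℝ × ℝ) : cover (y.1, Int.fract y.2.1, Int.fract y.2.2) = cover y := by
  simp [cover]

lemma tsupport_periodize_subset {ψ : ℝ × ℝ × ℝ → ℝ} (hc : HasCompactSupport ψ) :
    tsupport (periodize ψ) ⊆ cover '' tsupport ψ := by
  refine closure_minimal ?_ (IsCompact.image hc continuous_cover).isClosed
  intro p hp
  obtain ⟨y, rfl⟩ := surjective_cover p
  rw [Function.mem_support, periodize_cover] at hp
  exact ⟨_, subset_tsupport _ hp, cover_fract y⟩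

lemma eventually_fract_eq {x : ℝ} (hx : Int.fract x ≠ 0) :
    ∀ᶠ y : ℝ in nhds x, Int.fract y = y - ⌊x⌋ := by
  have h1 : (⌊x⌋ : ℝ) < x := by
    have := Int.fract_nonneg x
    have h2 := Int.self_sub_floor x
    rcases this.lt_or_eq with h | h
    · linarith
    · exact absurd h.symm hx
  filter_upwards [Ioo_mem_nhds h1 (Int.lt_floor_add_one x)] with y hy
  rw [Int.fract, sub_right_inj, Int.cast_inj, Int.floor_eq_iff]
  exact ⟨hy.1.le, hy.2⟩

/-- Periodizing a smooth function with compact support in the interior of the cell gives a test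
function. These suffice for the fundamental lemma, as the boundary of the cell is a null set. -/
lemma isTest_periodize {a b : ℝ} (ha : 0 ≤ a) (hb : b ≤ 1) {ψ : ℝ × ℝ × ℝ → ℝ}
    (hψ : ContDiff ℝ ∞ ψ) (hc : HasCompactSupport ψ)
    (hs : tsupport ψ ⊆ Ioo a b ×ˢ Ioo (0 : ℝ) 1 ×ˢ Ioo (0 : ℝ) 1) : IsTest (periodize ψ) where
  compact := HasCompactSupport.of_support_subset_isCompact (IsCompact.image hc continuous_cover)
    ((subset_tsupport _).trans (tsupport_periodize_subset hc))
  support := by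
    refine (tsupport_periodize_subset hc).trans ?_
    rintro _ ⟨y, hy, rfl⟩
    have := hs hy
    exact ⟨⟨ha.trans_lt this.1.1, this.1.2.trans_le hb⟩, mem_univ _⟩
  smooth := by
    change ContDiff ℝ ∞ (periodize ψ ∘ cover)
    rw [contDiff_iff_contDiffAt]
    intro y
    by_cases hy : cover y ∈ cover '' tsupport ψ
    · -- In the cell containing `y` the periodization is a translate of `ψ`.
      obtain ⟨u, hu, huy⟩ := hy
      have hu' := hs hu
      have e1 : Int.fract y.2.1 = u.2.1 := by
        have h : (u.2.1 : UnitAddCircle) = (Int.fract y.2.1 : ℝ) := by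
          rw [AddCircle.coe_fract]; exact congrArg (fun q : Cyl => q.2.1) huy
        exact ((AddCircle.coe_eq_coe_iff_of_mem_Ico (p := (1 : ℝ)) (a := 0)
          (by simpa using ⟨hu'.2.1.1.le, hu'.2.1.2⟩)
          ⟨Int.fract_nonneg _, by simpa using Int.fract_lt_one _⟩).1 h).symm
      have e2 : Int.fract y.2.2 = u.2.2 := by
        have h : (u.2.2 : UnitAddCircle) = (Int.fract y.2.2 : ℝ) := by
          rw [AddCircle.coe_fract]; exact congrArg (fun q : Cyl => q.2.2) huy
        exact ((AddCircle.coe_eq_coe_iff_of_mem_Ico (p := (1 : ℝ)) (a := 0)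
          (by simpa using ⟨hu'.2.2.1.le, hu'.2.2.2⟩)
          ⟨Int.fract_nonneg _, by simpa using Int.fract_lt_one _⟩).1 h).symm
      have h1 : ∀ᶠ v : ℝ × ℝ × ℝ in nhds y, Int.fract v.2.1 = v.2.1 - ⌊y.2.1⌋ :=
        (continuous_fst.comp continuous_snd).continuousAt.eventually
          (eventually_fract_eq (e1.trans_ne hu'.2.1.1.ne'))
      have h2 : ∀ᶠ v : ℝ × ℝ × ℝ in nhds y, Int.fract v.2.2 = v.2.2 - ⌊y.2.2⌋ :=
        (continuous_snd.comp continuous_snd).continuousAt.eventually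
          (eventually_fract_eq (e2.trans_ne hu'.2.2.1.ne'))
      have h3 : ContDiffAt ℝ ∞
          (fun v : ℝ × ℝ × ℝ => ψ (v.1, v.2.1 - ⌊y.2.1⌋, v.2.2 - ⌊y.2.2⌋)) y :=
        hψ.contDiffAt.comp y (by fun_prop)
      refine h3.congr_of_eventuallyEq ?_
      filter_upwards [h1, h2] with v h1 h2
      simp only [Function.comp_apply, periodize_cover, h1, h2]
    · have h1 : ∀ᶠ v in nhds y, cover v ∉ cover '' tsupport ψ :=
        continuous_cover.continuousAt.eventually
          ((IsCompact.image hc continuous_cover).isClosed.isOpen_compl.mem_nhds hy)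
      refine (contDiffAt_const (c := (0 : ℝ))).congr_of_eventuallyEq ?_
      filter_upwards [h1] with v hv
      by_contra hne
      exact hv (tsupport_periodize_subset hc (subset_tsupport _ hne))

lemma volume_restrict_strip (s : Set ℝ) :
    (volume : Measure Cyl).restrict (s ×ˢ univ) = (volume.restrict s).prod volume := by
  rw [Measure.volume_eq_prod, ← Measure.prod_restrict, Measure.restrict_univ]

lemma volume_restrict_cell (s : Set ℝ) :
    (volume : Measure (ℝ × ℝ × ℝ)).restrict (s ×ˢ Ioc (0 : ℝ) 1 ×ˢ Ioc (0 : ℝ) 1) =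
      (volume.restrict s).prod ((volume.restrict (Ioc 0 1)).prod (volume.restrict (Ioc 0 1))) := by
  rw [Measure.volume_eq_prod, ← Measure.prod_restrict, Measure.volume_eq_prod,
    ← Measure.prod_restrict]

lemma measurePreserving_cover (s : Set ℝ) :
    MeasurePreserving cover (volume.restrict (s ×ˢ Ioc (0 : ℝ) 1 ×ˢ Ioc (0 : ℝ) 1))
      (volume.restrict (s ×ˢ univ)) := by
  rw [volume_restrict_cell, volume_restrict_strip]
  have h : MeasurePreserving (fun s : ℝ => (s : UnitAddCircle)) (volume.restrict (Ioc 0 1))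
      volume := by
    simpa using UnitAddCircle.measurePreserving_mk 0
  exact (MeasurePreserving.id _).prod (h.prod h)

lemma ae_cell_eq (s : Set ℝ) :
    (s ×ˢ Ioo (0 : ℝ) 1 ×ˢ Ioo (0 : ℝ) 1 : Set (ℝ × ℝ × ℝ)) =ᵐ[volume]
      s ×ˢ Ioc (0 : ℝ) 1 ×ˢ Ioc (0 : ℝ) 1 := by
  rw [Measure.volume_eq_prod]
  refine Measure.set_prod_ae_eq (by rfl) ?_
  rw [Measure.volume_eq_prod]
  exact Measure.set_prod_ae_eq Ioo_ae_eq_Ioc Ioo_ae_eq_Ioc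

/-- The fundamental lemma of the calculus of variations on a strip of `ℝ × 𝕋²`. -/
lemma ae_eq_zero_of_integral_isTest {a b : ℝ} (ha : 0 ≤ a) (hb : b ≤ 1) {H : Cyl → ℝ}
    (hH : IntegrableOn H (Ioo a b ×ˢ univ))
    (h : ∀ φ : Cyl → ℝ, IsTest φ → tsupport φ ⊆ Ioo a b ×ˢ univ →
      ∫ p in Ioo a b ×ˢ univ, H p * φ p = 0) :
    ∀ᵐ p ∂(volume.restrict (Ioo a b ×ˢ univ : Set Cyl)), H p = 0 := by
  have hmp := measurePreserving_cover (Ioo a b)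
  have hmo : MeasurableSet (Ioo a b ×ˢ Ioo (0 : ℝ) 1 ×ˢ Ioo (0 : ℝ) 1) :=
    measurableSet_Ioo.prod (measurableSet_Ioo.prod measurableSet_Ioo)
  have hint : IntegrableOn (H ∘ cover) (Ioo a b ×ˢ Ioo (0 : ℝ) 1 ×ˢ Ioo (0 : ℝ) 1) := by
    rw [IntegrableOn, Measure.restrict_congr_set (ae_cell_eq _)]
    exact hmp.integrable_comp_of_integrable hH
  have key : ∀ᵐ y ∂(volume : Measure (ℝ × ℝ × ℝ)),
      y ∈ Ioo a b ×ˢ Ioo (0 : ℝ) 1 ×ˢ Ioo (0 : ℝ) 1 → (H ∘ cover) y = 0 := by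
    refine IsOpen.ae_eq_zero_of_integral_contDiff_smul_eq_zero
      (isOpen_Ioo.prod (isOpen_Ioo.prod isOpen_Ioo)) hint.locallyIntegrableOn ?_
    intro ψ hψ hc hs
    have ht := isTest_periodize ha hb hψ hc hs
    have h1 := h _ ht (by
      refine (tsupport_periodize_subset hc).trans ?_
      rintro _ ⟨y, hy, rfl⟩
      exact ⟨(hs hy).1, mem_univ _⟩)
    have hHφ : AEStronglyMeasurable (fun p => H p * periodize ψ p)
        (volume.restrict (Ioo a b ×ˢ univ : Set Cyl)) :=
      hH.aestronglyMeasurable.mul ht.continuous.aestronglyMeasurable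
    have h2 := hmp.map_eq ▸ integral_map (φ := cover) hmp.measurable.aemeasurable
      (f := fun p => H p * periodize ψ p) (by rw [hmp.map_eq]; exact hHφ)
    rw [← h1, h2, ← Measure.restrict_congr_set (ae_cell_eq _)]
    rw [← setIntegral_eq_integral_of_forall_compl_eq_zero
      (s := Ioo a b ×ˢ Ioo (0 : ℝ) 1 ×ˢ Ioo (0 : ℝ) 1)]
    · refine setIntegral_congr_fun hmo fun y hy => ?_
      simp only [smul_eq_mul, Function.comp_apply, periodize_cover]
      rw [Int.fract_eq_self.2 ⟨hy.2.1.1.le, hy.2.1.2⟩, Int.fract_eq_self.2 ⟨hy.2.2.1.le, hy.2.2.2⟩,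
        mul_comm]
    · intro y hy
      have : ψ y = 0 := by
        by_contra hne
        exact hy (hs (subset_tsupport _ hne))
      simp [this]
  have h3 : ∀ᵐ y ∂(volume.restrict (Ioo a b ×ˢ Ioc (0 : ℝ) 1 ×ˢ Ioc (0 : ℝ) 1)),
      H (cover y) = 0 := by
    rw [← Measure.restrict_congr_set (ae_cell_eq _)]
    exact (ae_restrict_iff' hmo).2 key
  obtain ⟨H', hH', hHH'⟩ := hH.aestronglyMeasurable
  have h4 := hmp.quasiMeasurePreserving.ae hHH'
  have h5 : ∀ᵐ p ∂(volume.restrict (Ioo a b ×ˢ univ : Set Cyl)), H' p = 0 := by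
    rw [← hmp.map_eq]
    refine (ae_map_iff hmp.measurable.aemeasurable
      (hH'.measurable (measurableSet_singleton 0))).2 ?_
    filter_upwards [h3, h4] with y h3 h4
    exact h4.symm.trans h3
  filter_upwards [hHH', h5] with p h6 h7
  rw [h6, h7]

/-! ### Translates of a function with a weak derivative -/

instance : IsProbabilityMeasure (volume : Measure UnitAddCircle) := ⟨by simp⟩

-- Instance search does not see `volume` on a product type as a product of measures.
instance : IsProbabilityMeasure (volume : Measure (UnitAddCircle × UnitAddCircle)) :=
  inferInstanceAs (IsProbabilityMeasure
    ((volume : Measure UnitAddCircle).prod (volume : Measure UnitAddCircle)))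

instance : (volume : Measure (UnitAddCircle × UnitAddCircle)).IsAddLeftInvariant :=
  inferInstanceAs (((volume : Measure UnitAddCircle).prod
    (volume : Measure UnitAddCircle)).IsAddLeftInvariant)

instance : (volume : Measure Cyl).IsAddLeftInvariant :=
  Measure.prod.instIsAddLeftInvariant (μ := (volume : Measure ℝ))
    (ν := (volume : Measure (UnitAddCircle × UnitAddCircle)))

instance : (volume : Measure (UnitAddCircle × UnitAddCircle)).IsAddRightInvariant :=
  IsAddLeftInvariant.isAddRightInvariant

instance : (volume : Measure Cyl).IsAddRightInvariant :=
  IsAddLeftInvariant.isAddRightInvariant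

instance (a b : ℝ) : IsFiniteMeasure (volume.restrict (uIoc a b)) :=
  inferInstanceAs (IsFiniteMeasure (volume.restrict (Ioc (min a b) (max a b))))

lemma setIntegral_Omega_mul {S : Set Cyl} (hS : S ⊆ Omega) (W : Cyl → ℝ) {ψ : Cyl → ℝ}
    (hψ : ∀ p ∉ S, ψ p = 0) : ∫ p in Omega, W p * ψ p = ∫ p, S.indicator W p * ψ p := by
  have h : ∀ p, W p * ψ p = S.indicator W p * ψ p := fun p => by
    by_cases hp : p ∈ S
    · simp [hp]
    · simp [hψ p hp]
  rw [setIntegral_eq_integral_of_forall_compl_eq_zero fun p hp => by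
    simp [hψ p fun h => hp (hS h)]]
  exact integral_congr_ae (Filter.Eventually.of_forall h)

lemma integrable_comp_add_shift (i : Fin 3) {g : Cyl → ℝ} (hg : Integrable g) (s : ℝ) :
    Integrable (fun q : ℝ × Cyl => g (q.2 + shift i q.1))
      ((volume.restrict (uIoc 0 s)).prod volume) := by
  have hmp : MeasurePreserving (fun q : ℝ × Cyl => (q.1, q.2 + shift i q.1))
      ((volume.restrict (uIoc 0 s)).prod volume) ((volume.restrict (uIoc 0 s)).prod volume) := by
    refine (MeasurePreserving.id _).skew_product (g := fun t p => p + shift i t) ?_ ?_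
    · exact (continuous_snd.add ((continuous_shift i).comp continuous_fst)).measurable
    · exact Filter.Eventually.of_forall fun t => (measurePreserving_add_right volume _).map_eq
  exact hmp.integrable_comp_of_integrable (g := fun q : ℝ × Cyl => g q.2) (hg.comp_snd _)

/-- Along the direction `i`, a function with weak derivative `g` is a primitive of `g`: tested against
`φ`, the difference of the two sides is the integral over `t` of the defining identity of `g` for
the translates `φ(· - t eᵢ)`. All these translates are supported in the strip `Ioo a b ×ˢ univ`. -/
lemma IsWeakDeriv.ae_sub_eq_intervalIntegral {i : Fin 3} {W g : Cyl → ℝ} (h : IsWeakDeriv i W g)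
    {a b c d s : ℝ} (ha : 0 ≤ a) (hb : b ≤ 1) (hc : 0 ≤ c) (hd : d ≤ 1)
    (hW : IntegrableOn W (Ioo a b ×ˢ univ)) (hg : IntegrableOn g (Ioo a b ×ˢ univ))
    (hs : ∀ z ∈ Ioo c d, ∀ t ∈ uIcc 0 s, z + (shift i t).1 ∈ Ioo a b) :
    ∀ᵐ p ∂(volume.restrict (Ioo c d ×ˢ univ : Set Cyl)),
      W (p + shift i s) - W p = ∫ t in (0 : ℝ)..s, g (p + shift i t) := by
  set S : Set Cyl := Ioo a b ×ˢ univ with hSdef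
  set U : Set Cyl := Ioo c d ×ˢ univ with hUdef
  have hSm : MeasurableSet S := measurableSet_Ioo.prod MeasurableSet.univ
  have hUm : MeasurableSet U := measurableSet_Ioo.prod MeasurableSet.univ
  have hSO : S ⊆ Omega := fun p hp => ⟨⟨ha.trans_lt hp.1.1, hp.1.2.trans_le hb⟩, mem_univ _⟩
  have hUS : ∀ p ∈ U, ∀ t ∈ uIcc 0 s, p + shift i t ∈ S := fun p hp t ht =>
    ⟨hs _ hp.1 t ht, mem_univ _⟩
  have hWi : Integrable (S.indicator W) := hW.integrable_indicator hSm
  have hgi : Integrable (S.indicator g) := hg.integrable_indicator hSm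
  have hGp := integrable_comp_add_shift i hgi s
  have hGi : Integrable (fun p => ∫ t in (0 : ℝ)..s, S.indicator g (p + shift i t)) := by
    simp only [intervalIntegral.intervalIntegral_eq_integral_uIoc]
    exact (hGp.integral_prod_right).smul (if (0 : ℝ) ≤ s then (1 : ℝ) else -1)
  have hWs : Integrable (fun p => S.indicator W (p + shift i s)) := hWi.comp_add_right _
  set H : Cyl → ℝ := fun p => S.indicator W (p + shift i s) - S.indicator W p -
    ∫ t in (0 : ℝ)..s, S.indicator g (p + shift i t) with hHdef
  have hHi : Integrable H := (hWs.sub hWi).sub hGi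
  have key : ∀ᵐ p ∂(volume.restrict U), H p = 0 := by
    refine ae_eq_zero_of_integral_isTest hc hd hHi.integrableOn fun φ hφ hφU => ?_
    rw [setIntegral_eq_integral_of_forall_compl_eq_zero fun p hp => by
      rw [image_eq_zero_of_notMem_tsupport fun h => hp (hφU h), mul_zero]]
    obtain ⟨C, hC⟩ := hφ.exists_bound
    obtain ⟨C', hC'⟩ := hφ.exists_bound_partialD i
    have hcont := hφ.continuous
    have hcs : ∀ t, Continuous fun q => φ (q - shift i t) := fun t =>
      hcont.comp (continuous_id.sub continuous_const)
    -- the integral of the translate of `W`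
    have e1 : ∫ p, S.indicator W (p + shift i s) * φ p =
        ∫ q, S.indicator W q * φ (q - shift i s) := by
      rw [← integral_sub_right_eq_self _ (shift i s)]
      simp
    have i1 : Integrable fun q => S.indicator W q * φ (q - shift i s) :=
      hWi.mul_bdd (hcs s).aestronglyMeasurable (Filter.Eventually.of_forall fun q => hC _)
    have i2 : Integrable fun q => S.indicator W q * φ q :=
      hWi.mul_bdd hcont.aestronglyMeasurable (Filter.Eventually.of_forall fun q => hC _)
    have hder : ∀ q t, HasDerivAt (fun t => φ (q - shift i t)) (-partialD i φ (q - shift i t)) t := by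
      intro q t
      have h1 := (hφ.hasDerivAt_shift i q (-t)).comp t (hasDerivAt_neg t)
      simpa [Function.comp_def, shift_neg, sub_eq_add_neg] using h1
    have hcd : ∀ q, Continuous fun t => -partialD i φ (q - shift i t) := fun q =>
      ((hφ.continuous_partialD i).comp (continuous_const.sub (continuous_shift i))).neg
    have e2 : (∫ q, S.indicator W q * φ (q - shift i s)) - ∫ q, S.indicator W q * φ q =
        ∫ q, ∫ t in (0 : ℝ)..s, S.indicator W q * -partialD i φ (q - shift i t) := by
      rw [← integral_sub i1 i2]
      refine integral_congr_ae (Filter.Eventually.of_forall fun q => ?_)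
      simp only
      rw [intervalIntegral.integral_const_mul,
        intervalIntegral.integral_eq_sub_of_hasDerivAt (fun t _ => hder q t)
          ((hcd q).intervalIntegrable _ _), shift_zero, sub_zero, mul_sub]
    have e3 : ∫ q, ∫ t in (0 : ℝ)..s, S.indicator W q * -partialD i φ (q - shift i t) =
        ∫ t in (0 : ℝ)..s, ∫ q, S.indicator W q * -partialD i φ (q - shift i t) := by
      rw [intervalIntegral_integral_swap]
      have : Integrable (fun x : ℝ × Cyl => S.indicator W x.2)
          ((volume.restrict (uIoc 0 s)).prod volume) := hWi.comp_snd _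
      refine this.mul_bdd (c := C') ?_ (Filter.Eventually.of_forall fun q => ?_)
      · exact ((hφ.continuous_partialD i).comp (continuous_snd.sub
          ((continuous_shift i).comp continuous_fst))).neg.aestronglyMeasurable
      · simpa using hC' _
    -- the weak derivative, tested against the translate of `φ`
    have e4 : ∀ t ∈ uIcc 0 s, ∫ q, S.indicator W q * -partialD i φ (q - shift i t) =
        ∫ p, S.indicator g (p + shift i t) * φ p := by
      intro t ht
      have hsup : tsupport (fun q => φ (q - shift i t)) ⊆ S := by
        rw [tsupport_comp_sub]
        intro q hq
        simpa using hUS _ (hφU hq) t ht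
      have htest := hφ.comp_sub_shift i t fun p hp => hSO (hUS _ (hφU hp) t ht)
      have h1 := h.integral_eq _ htest
      rw [setIntegral_Omega_mul hSO W fun p hp => IsTest.partialD_eq_zero i fun h => hp (hsup h),
        setIntegral_Omega_mul hSO g fun p hp =>
          image_eq_zero_of_notMem_tsupport fun h => hp (hsup h)] at h1
      simp only [partialD_comp_sub] at h1
      simp only [mul_neg, integral_neg, h1, neg_neg]
      rw [← integral_sub_right_eq_self (fun p => S.indicator g (p + shift i t) * φ p) (shift i t)]
      simp
    have e5 : ∫ t in (0 : ℝ)..s, ∫ p, S.indicator g (p + shift i t) * φ p =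
        ∫ p, (∫ t in (0 : ℝ)..s, S.indicator g (p + shift i t)) * φ p := by
      rw [intervalIntegral_integral_swap]
      · simp only [intervalIntegral.integral_mul_const]
      · exact hGp.mul_bdd (hcont.comp continuous_snd).aestronglyMeasurable
          (Filter.Eventually.of_forall fun q => hC _)
    have e6 : ∫ t in (0 : ℝ)..s, ∫ q, S.indicator W q * -partialD i φ (q - shift i t) =
        ∫ t in (0 : ℝ)..s, ∫ p, S.indicator g (p + shift i t) * φ p :=
      intervalIntegral.integral_congr e4
    have i3 : Integrable fun p => S.indicator W (p + shift i s) * φ p :=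
      hWs.mul_bdd hcont.aestronglyMeasurable (Filter.Eventually.of_forall fun q => hC _)
    have i4 : Integrable fun p => (∫ t in (0 : ℝ)..s, S.indicator g (p + shift i t)) * φ p :=
      hGi.mul_bdd hcont.aestronglyMeasurable (Filter.Eventually.of_forall fun q => hC _)
    simp only [hHdef, sub_mul]
    have e7 := integral_sub (i3.sub i2) i4
    simp only [Pi.sub_apply] at e7
    rw [e7, integral_sub i3 i2, e1, e2, e3, e6, e5, sub_self]
  rw [ae_restrict_iff' hUm] at key ⊢
  filter_upwards [key] with p hp hpU
  have h1 := hp hpU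
  have h0 := hUS p hpU 0 left_mem_uIcc
  rw [shift_zero, add_zero] at h0
  simp only [hHdef, indicator_of_mem (hUS p hpU s right_mem_uIcc), indicator_of_mem h0,
    sub_eq_zero] at h1
  rw [h1]
  exact intervalIntegral.integral_congr fun t ht => indicator_of_mem (hUS p hpU t ht) g

/-! ### Cauchy–Schwarz inequalities -/

section CauchySchwarz

variable {α : Type*} [MeasurableSpace α] {μ : Measure α}

lemma sq_lintegral_mul_le {f g : α → ℝ≥0∞} (hf : AEMeasurable f μ) (hg : AEMeasurable g μ) :
    (∫⁻ x, f x * g x ∂μ) ^ 2 ≤ (∫⁻ x, f x ^ 2 ∂μ) * ∫⁻ x, g x ^ 2 ∂μ := by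
  have h := ENNReal.lintegral_mul_le_Lp_mul_Lq μ Real.HolderConjugate.two_two hf hg
  simp only [Pi.mul_apply, ENNReal.rpow_two] at h
  have hr : ∀ a : ℝ≥0∞, (a ^ (1 / (2 : ℝ))) ^ 2 = a := fun a => by
    rw [← ENNReal.rpow_two, ← ENNReal.rpow_mul]; norm_num
  calc (∫⁻ x, f x * g x ∂μ) ^ 2
      ≤ ((∫⁻ x, f x ^ 2 ∂μ) ^ (1 / (2 : ℝ)) * (∫⁻ x, g x ^ 2 ∂μ) ^ (1 / (2 : ℝ))) ^ 2 := by gcongr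
    _ = _ := by rw [mul_pow, hr, hr]

lemma enorm_sq_eq_ofReal (x : ℝ) : ‖x‖ₑ ^ 2 = ENNReal.ofReal (x ^ 2) := by
  rw [Real.enorm_eq_ofReal_abs, ← ENNReal.ofReal_pow (abs_nonneg x), sq_abs]

lemma ofReal_sq_integral_le {f : α → ℝ} (hf : AEMeasurable f μ) :
    ENNReal.ofReal ((∫ x, f x ∂μ) ^ 2) ≤ μ univ * ∫⁻ x, ENNReal.ofReal (f x ^ 2) ∂μ := by
  have h1 := sq_lintegral_mul_le (μ := μ) (f := fun _ => 1) aemeasurable_const hf.enorm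
  simp only [one_mul, one_pow, lintegral_const, enorm_sq_eq_ofReal] at h1
  rw [← enorm_sq_eq_ofReal]
  exact (pow_le_pow_left' (enorm_integral_le_lintegral_enorm f) 2).trans h1

lemma sq_integral_mul_le {f g : α → ℝ} (hf : AEMeasurable f μ) (hg : AEMeasurable g μ)
    (hf2 : Integrable (fun x => f x ^ 2) μ) (hg2 : Integrable (fun x => g x ^ 2) μ) :
    (∫ x, f x * g x ∂μ) ^ 2 ≤ (∫ x, f x ^ 2 ∂μ) * ∫ x, g x ^ 2 ∂μ := by
  have h1 := sq_lintegral_mul_le (μ := μ) hf.enorm hg.enorm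
  simp only [← enorm_mul, enorm_sq_eq_ofReal] at h1
  rw [← ofReal_integral_eq_lintegral_ofReal hf2 (Filter.Eventually.of_forall fun x => sq_nonneg _),
    ← ofReal_integral_eq_lintegral_ofReal hg2 (Filter.Eventually.of_forall fun x => sq_nonneg _),
    ← ENNReal.ofReal_mul (integral_nonneg fun x => sq_nonneg _)] at h1
  have h2 := (pow_le_pow_left' (enorm_integral_le_lintegral_enorm
    (μ := μ) (fun x => f x * g x)) 2).trans h1
  rw [enorm_sq_eq_ofReal] at h2
  exact (ENNReal.ofReal_le_ofReal_iff (mul_nonneg (integral_nonneg fun x => sq_nonneg _)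
    (integral_nonneg fun x => sq_nonneg _))).1 h2

end CauchySchwarz

/-! ### The weak derivatives on lines and on translates -/

lemma integrableOn_strip {W : Cyl → ℝ} (hW : LocallyIntegrableOn W Omega) {a b : ℝ}
    (ha : 0 < a) (hb : b < 1) : IntegrableOn W (Ioo a b ×ˢ univ) := by
  have h : IntegrableOn W (Icc a b ×ˢ univ) :=
    hW.integrableOn_compact_subset
      (prod_mono (fun z hz => ⟨ha.trans_le hz.1, hz.2.trans_lt hb⟩) subset_rfl)
      (isCompact_Icc.prod isCompact_univ)
  exact h.mono_set (prod_mono Ioo_subset_Icc_self subset_rfl)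

/-- The two functions are only locally integrable, so the cylinder is exhausted by strips which stay
away from `z = 0` and `z = 1`. -/
lemma IsWeakDeriv.ae_sub_eq_vertical {W g : Cyl → ℝ} (h : IsWeakDeriv 0 W g) (s : ℝ) :
    ∀ᵐ p : Cyl, p.1 ∈ Ioo (0 : ℝ) 1 → p.1 + s ∈ Ioo (0 : ℝ) 1 →
      W (p.1 + s, p.2) - W p = ∫ t in p.1..p.1 + s, g (t, p.2) := by
  have key : ∀ n : ℕ, ∀ᵐ p : Cyl, p.1 ∈ Ioo (1 / ((n : ℝ) + 1)) (1 - 1 / ((n : ℝ) + 1)) →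
      p.1 + s ∈ Ioo (1 / ((n : ℝ) + 1)) (1 - 1 / ((n : ℝ) + 1)) →
      W (p.1 + s, p.2) - W p = ∫ t in p.1..p.1 + s, g (t, p.2) := by
    intro n
    set a : ℝ := 1 / ((n : ℝ) + 1) with ha
    have ha0 : 0 < a := by positivity
    have hb1 : 1 - a < 1 := by linarith
    have h1 := h.ae_sub_eq_intervalIntegral (a := a) (b := 1 - a) (c := max a (a - s))
      (d := min (1 - a) (1 - a - s)) (s := s) ha0.le hb1.le (le_max_of_le_left ha0.le)
      (min_le_of_left_le hb1.le) (integrableOn_strip h.locInt ha0 hb1)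
      (integrableOn_strip h.locInt_deriv ha0 hb1) (by
        intro z hz t ht
        simp only [shift, Matrix.cons_val_zero]
        obtain ⟨h1, h2⟩ := hz
        rw [max_lt_iff] at h1
        rw [lt_min_iff] at h2
        rcases le_total 0 s with hs | hs
        · rw [uIcc_of_le hs] at ht
          exact ⟨by linarith [ht.1], by linarith [ht.2]⟩
        · rw [uIcc_of_ge hs] at ht
          exact ⟨by linarith [ht.1], by linarith [ht.2]⟩)
    rw [ae_restrict_iff' (measurableSet_Ioo.prod MeasurableSet.univ)] at h1
    filter_upwards [h1] with p hp hp1 hp2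
    have h2 := hp ⟨⟨max_lt hp1.1 (by linarith [hp2.1]), lt_min hp1.2 (by linarith [hp2.2])⟩,
      mem_univ _⟩
    have e : ∀ t, p + shift 0 t = (p.1 + t, p.2) := fun t => by
      simp [shift, Prod.ext_iff]
    simp only [e] at h2
    rw [h2, intervalIntegral.integral_comp_add_left (fun t => g (t, p.2)), add_zero]
  have h2 : ∀ᵐ p : Cyl, ∀ n : ℕ, p.1 ∈ Ioo (1 / ((n : ℝ) + 1)) (1 - 1 / ((n : ℝ) + 1)) →
      p.1 + s ∈ Ioo (1 / ((n : ℝ) + 1)) (1 - 1 / ((n : ℝ) + 1)) →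
      W (p.1 + s, p.2) - W p = ∫ t in p.1..p.1 + s, g (t, p.2) := ae_all_iff.2 key
  filter_upwards [h2] with p hp h3 h4
  obtain ⟨n, hn⟩ := exists_nat_one_div_lt (lt_min (lt_min h3.1 (sub_pos.2 h3.2))
    (lt_min h4.1 (sub_pos.2 h4.2)))
  simp only [lt_min_iff] at hn
  exact hp n ⟨hn.1.1, by linarith [hn.1.2]⟩ ⟨hn.2.1, by linarith [hn.2.2]⟩

lemma measurable_integral_Ioc {g : Cyl → ℝ} (hg : Measurable g) :
    Measurable fun r : (UnitAddCircle × UnitAddCircle) × ℝ × ℝ =>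
      ∫ t in Ioc r.2.1 r.2.2, g (t, r.1) := by
  have h : ∀ r : (UnitAddCircle × UnitAddCircle) × ℝ × ℝ, ∫ t in Ioc r.2.1 r.2.2, g (t, r.1) =
      ∫ t, {q : ((UnitAddCircle × UnitAddCircle) × ℝ × ℝ) × ℝ |
        q.1.2.1 < q.2 ∧ q.2 ≤ q.1.2.2}.indicator (fun q => g (q.2, q.1.1)) (r, t) := by
    intro r
    rw [← integral_indicator measurableSet_Ioc]
    rfl
  simp only [h]
  refine (StronglyMeasurable.integral_prod_right (f := fun r t =>
    {q : ((UnitAddCircle × UnitAddCircle) × ℝ × ℝ) × ℝ |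
        q.1.2.1 < q.2 ∧ q.2 ≤ q.1.2.2}.indicator (fun q => g (q.2, q.1.1)) (r, t)) ?_).measurable
  have h1 : Measurable fun q : ((UnitAddCircle × UnitAddCircle) × ℝ × ℝ) × ℝ => q.1.2.1 := by
    fun_prop
  have h2 : Measurable fun q : ((UnitAddCircle × UnitAddCircle) × ℝ × ℝ) × ℝ => q.1.2.2 := by
    fun_prop
  have h3 : Measurable fun q : ((UnitAddCircle × UnitAddCircle) × ℝ × ℝ) × ℝ => g (q.2, q.1.1) := by
    fun_prop
  exact (h3.indicator ((measurableSet_lt h1 measurable_snd).inter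
    (measurableSet_le measurable_snd h2))).stronglyMeasurable

/-- On almost every vertical segment, `W` is a primitive of its weak derivative. The exceptional set
in `ae_sub_eq_vertical` depends on the increment `s`; by Fubini this becomes a statement about
almost all pairs of points of almost every segment. -/
lemma IsWeakDeriv.ae_line {W g : Cyl → ℝ} (h : IsWeakDeriv 0 W g) (hW : Measurable W)
    (hg : Measurable g) :
    ∀ᵐ x : UnitAddCircle × UnitAddCircle,
      ∀ᵐ q ∂((volume.restrict (Ioo (0 : ℝ) 1)).prod (volume.restrict (Ioo (0 : ℝ) 1))),
        W (q.2, x) - W (q.1, x) = ∫ t in q.1..q.2, g (t, x) := by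
  set P : (UnitAddCircle × UnitAddCircle) × ℝ × ℝ → Prop := fun r =>
    r.2.1 ∈ Ioo (0 : ℝ) 1 → r.2.2 ∈ Ioo (0 : ℝ) 1 →
      W (r.2.2, r.1) - W (r.2.1, r.1) = ∫ t in r.2.1..r.2.2, g (t, r.1) with hP
  have hPm : MeasurableSet {r | P r} := by
    have h1 : Measurable fun r : (UnitAddCircle × UnitAddCircle) × ℝ × ℝ =>
        ∫ t in r.2.1..r.2.2, g (t, r.1) := by
      unfold intervalIntegral
      refine (measurable_integral_Ioc hg).sub ?_
      exact (measurable_integral_Ioc hg).comp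
        (f := fun r : (UnitAddCircle × UnitAddCircle) × ℝ × ℝ => (r.1, r.2.2, r.2.1)) (by fun_prop)
    have h2 : Measurable fun r : (UnitAddCircle × UnitAddCircle) × ℝ × ℝ => r.2.1 := by fun_prop
    have h3 : Measurable fun r : (UnitAddCircle × UnitAddCircle) × ℝ × ℝ => r.2.2 := by fun_prop
    have h4 : Measurable fun r : (UnitAddCircle × UnitAddCircle) × ℝ × ℝ =>
        W (r.2.2, r.1) - W (r.2.1, r.1) := by fun_prop
    have e : {r | P r} = ((fun r : (UnitAddCircle × UnitAddCircle) × ℝ × ℝ => r.2.1) ⁻¹'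
        Ioo (0 : ℝ) 1)ᶜ ∪ ((fun r : (UnitAddCircle × UnitAddCircle) × ℝ × ℝ => r.2.2) ⁻¹'
        Ioo (0 : ℝ) 1)ᶜ ∪ {r : (UnitAddCircle × UnitAddCircle) × ℝ × ℝ |
          W (r.2.2, r.1) - W (r.2.1, r.1) = ∫ t in r.2.1..r.2.2, g (t, r.1)} := by
      ext r
      simp only [hP, mem_ofPred_eq, mem_union, mem_compl_iff, mem_preimage]
      tauto
    rw [e]
    exact ((h2 measurableSet_Ioo).compl.union (h3 measurableSet_Ioo).compl).union
      (measurableSet_eq_fun h4 h1)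
  have h1 : ∀ᵐ s : ℝ, ∀ᵐ p : Cyl, P (p.2, p.1, p.1 + s) :=
    Filter.Eventually.of_forall fun s => h.ae_sub_eq_vertical s
  have h2 : ∀ᵐ p : Cyl, ∀ᵐ s : ℝ, P (p.2, p.1, p.1 + s) := by
    refine (Measure.ae_ae_comm ?_).1 h1
    exact hPm.preimage (f := fun q : ℝ × Cyl => (q.2.2, q.2.1, q.2.1 + q.1)) (by fun_prop)
  have h3 : ∀ᵐ p : Cyl, ∀ᵐ y : ℝ, P (p.2, p.1, y) := by
    filter_upwards [h2] with p hp
    have := (measurePreserving_add_right volume (-p.1)).quasiMeasurePreserving.ae hp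
    filter_upwards [this] with y hy
    simpa using hy
  have h4 : ∀ᵐ x : UnitAddCircle × UnitAddCircle, ∀ᵐ z : ℝ, ∀ᵐ y : ℝ, P (x, z, y) := by
    have := (Measure.measurePreserving_swap (μ := (volume : Measure (UnitAddCircle × UnitAddCircle)))
      (ν := (volume : Measure ℝ))).quasiMeasurePreserving.ae h3
    exact Measure.ae_ae_of_ae_prod this
  filter_upwards [h4] with x hx
  have h5 : ∀ᵐ q : ℝ × ℝ, P (x, q) :=
    (Measure.ae_prod_iff_ae_ae (hPm.preimage (f := fun q : ℝ × ℝ => (x, q)) (by fun_prop))).2 hx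
  rw [Measure.prod_restrict, ae_restrict_iff' (measurableSet_Ioo.prod measurableSet_Ioo)]
  filter_upwards [h5] with q hq hm
  exact hq hm.1 hm.2

lemma lintegral_Omega_comp_add (F : Cyl → ℝ≥0∞) (a : Cyl) (ha : a.1 = 0) :
    ∫⁻ p in Omega, F (p + a) = ∫⁻ p in Omega, F p := by
  have hm : MeasurableSet Omega := isOpen_Omega.measurableSet
  rw [← lintegral_indicator hm, ← lintegral_indicator hm,
    ← lintegral_add_right_eq_self (μ := volume) (Omega.indicator F) a]
  refine lintegral_congr fun p => ?_
  have : p + a ∈ Omega ↔ p ∈ Omega := by simp [Omega, ha]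
  by_cases hp : p ∈ Omega
  · rw [indicator_of_mem hp, indicator_of_mem (this.2 hp)]
  · rw [indicator_of_notMem hp, indicator_of_notMem fun h => hp (this.1 h)]

/-- A transversal translation by at most one period moves `W` in `L²` by at most the norm of its weak
derivative. -/
lemma IsWeakDeriv.lintegral_sq_sub_le {i : Fin 3} (hi : i ≠ 0) {W g : Cyl → ℝ}
    (h : IsWeakDeriv i W g) (hg : Measurable g) (hWi : IntegrableOn W Omega)
    {s : ℝ} (hs : s ∈ Icc (0 : ℝ) 1) :
    ∫⁻ p in Omega, ENNReal.ofReal ((W (p + shift i s) - W p) ^ 2) ≤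
      ∫⁻ p in Omega, ENNReal.ofReal (g p ^ 2) := by
  have hi0 : ∀ t, (shift i t).1 = 0 := by
    intro t; fin_cases i <;> simp_all [shift]
  by_cases hfin : ∫⁻ p in Omega, ENNReal.ofReal (g p ^ 2) = ⊤
  · rw [hfin]; exact le_top
  have : IsFiniteMeasure ((volume : Measure Cyl).restrict Omega) := by
    rw [Omega, volume_restrict_strip]; infer_instance
  have hg2 : MemLp g 2 (volume.restrict Omega) := by
    refine (memLp_two_iff_integrable_sq hg.aestronglyMeasurable).2
      ⟨(hg.pow_const 2).aestronglyMeasurable, ?_⟩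
    rw [hasFiniteIntegral_iff_ofReal (Filter.Eventually.of_forall fun p => sq_nonneg _)]
    exact lt_top_iff_ne_top.2 hfin
  have hgi : IntegrableOn g Omega := hg2.integrable (by norm_num)
  have h1 := h.ae_sub_eq_intervalIntegral (a := 0) (b := 1) (c := 0) (d := 1) (s := s) le_rfl le_rfl
    le_rfl le_rfl hWi hgi (fun z hz t _ => by simpa [hi0 t] using hz)
  have hcont := continuous_shift i
  have hmeas : Measurable fun q : Cyl × ℝ => ENNReal.ofReal (g (q.1 + shift i q.2) ^ 2) :=
    ENNReal.measurable_ofReal.comp ((hg.comp (by fun_prop)).pow_const 2)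
  calc ∫⁻ p in Omega, ENNReal.ofReal ((W (p + shift i s) - W p) ^ 2)
      ≤ ∫⁻ p in Omega, ∫⁻ t in Ioc 0 s, ENNReal.ofReal (g (p + shift i t) ^ 2) := by
        refine lintegral_mono_ae ?_
        filter_upwards [h1] with p hp
        rw [hp, intervalIntegral.integral_of_le hs.1]
        refine (ofReal_sq_integral_le ?_).trans ?_
        · exact (hg.comp (by fun_prop)).aemeasurable
        · refine mul_le_of_le_one_left' ?_
          simpa using hs.2
    _ = ∫⁻ t in Ioc 0 s, ∫⁻ p in Omega, ENNReal.ofReal (g (p + shift i t) ^ 2) :=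
        lintegral_lintegral_swap hmeas.aemeasurable
    _ = ∫⁻ t in Ioc 0 s, ∫⁻ p in Omega, ENNReal.ofReal (g p ^ 2) := by
        refine lintegral_congr fun t => ?_
        exact lintegral_Omega_comp_add (fun p => ENNReal.ofReal (g p ^ 2)) _ (hi0 t)
    _ ≤ _ := by
        rw [lintegral_const]
        refine mul_le_of_le_one_right' ?_
        simpa using hs.2

/-- The transversal derivatives control all transversal translates. -/
lemma lintegral_sq_sub_translate_le {W g₁ g₂ : Cyl → ℝ} (h₁ : IsWeakDeriv 1 W g₁)
    (h₂ : IsWeakDeriv 2 W g₂) (hW : Measurable W) (hg₁ : Measurable g₁) (hg₂ : Measurable g₂)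
    (hWi : IntegrableOn W Omega) (t : UnitAddCircle × UnitAddCircle) :
    ∫⁻ p in Omega, ENNReal.ofReal ((W (p.1, p.2 + t) - W p) ^ 2) ≤
      2 * ((∫⁻ p in Omega, ENNReal.ofReal (g₁ p ^ 2)) +
        ∫⁻ p in Omega, ENNReal.ofReal (g₂ p ^ 2)) := by
  obtain ⟨s₁, hs₁, e₁⟩ := AddCircle.eq_coe_Ico t.1
  obtain ⟨s₂, hs₂, e₂⟩ := AddCircle.eq_coe_Ico t.2
  have et : ∀ p : Cyl, (p.1, p.2 + t) = (p + shift 2 s₂) + shift 1 s₁ := fun p => by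
    simp [shift, Prod.ext_iff, e₁, e₂]
  have k₁ := h₁.lintegral_sq_sub_le (by decide) hg₁ hWi ⟨hs₁.1, hs₁.2.le⟩
  have k₂ := h₂.lintegral_sq_sub_le (by decide) hg₂ hWi ⟨hs₂.1, hs₂.2.le⟩
  have hF : Measurable fun p : Cyl => ENNReal.ofReal ((W (p + shift 1 s₁) - W p) ^ 2) :=
    ENNReal.measurable_ofReal.comp (((hW.comp (by fun_prop)).sub hW).pow_const 2)
  rw [← lintegral_Omega_comp_add _ (shift 2 s₂) (by simp [shift])] at k₁
  calc ∫⁻ p in Omega, ENNReal.ofReal ((W (p.1, p.2 + t) - W p) ^ 2)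
      ≤ ∫⁻ p in Omega, 2 * (ENNReal.ofReal ((W (p + shift 2 s₂ + shift 1 s₁) -
          W (p + shift 2 s₂)) ^ 2) + ENNReal.ofReal ((W (p + shift 2 s₂) - W p) ^ 2)) := by
        refine lintegral_mono fun p => ?_
        rw [← ENNReal.ofReal_add (sq_nonneg _) (sq_nonneg _), ← ENNReal.ofReal_ofNat 2,
          ← ENNReal.ofReal_mul (by norm_num), et p]
        refine ENNReal.ofReal_le_ofReal ?_
        nlinarith [sq_nonneg (W (p + shift 2 s₂ + shift 1 s₁) -
          W (p + shift 2 s₂) - (W (p + shift 2 s₂) - W p))]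
    _ ≤ _ := by
        rw [lintegral_const_mul' _ _ (by norm_num), lintegral_add_left
          (f := fun p : Cyl => ENNReal.ofReal ((W (p + shift 2 s₂ + shift 1 s₁) -
            W (p + shift 2 s₂)) ^ 2)) (hF.comp (measurable_add_const (shift 2 s₂)))]
        gcongr

/-! ### The weight `-1 - log z - log (1 - z)` -/

/-- The weight `Λ(z) = -1 - log z - log (1 - z)`, which is `∫ k(z, t)² / (t (1 - t)) dt` for the
kernel `k` representing a function of mean zero on `(0,1)` by its derivative. -/
def logWeight (z : ℝ) : ℝ := -1 - Real.log z - Real.log (1 - z)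

lemma measurable_logWeight : Measurable logWeight := by
  unfold logWeight
  fun_prop

/-- The inequality `x ≤ sinh x` at `x = log (1 / √z)`. -/
lemma neg_log_le {z : ℝ} (h0 : 0 < z) (h1 : z ≤ 1) : -Real.log z ≤ (1 - z) / √z := by
  have hr : 0 < √z := Real.sqrt_pos.2 h0
  have hr1 : √z ≤ 1 := Real.sqrt_le_one.2 h1
  have h2 : 0 ≤ Real.log (√z)⁻¹ := Real.log_nonneg ((one_le_inv₀ hr).2 hr1)
  have h3 := Real.self_le_sinh_iff.2 h2
  rw [Real.sinh_log (by positivity), Real.log_inv, Real.log_sqrt h0.le, inv_inv] at h3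
  have h4 : (1 - z) / √z = (√z)⁻¹ - √z := by
    rw [div_eq_iff hr.ne', sub_mul, inv_mul_cancel₀ hr.ne', Real.mul_self_sqrt h0.le]
  rw [h4]
  linarith

lemma log_mul_log_le {z : ℝ} (h0 : 0 < z) (h1 : z < 1) :
    Real.log z * Real.log (1 - z) ≤ z * (1 - z) + 1 / 4 := by
  have h2 : 0 < 1 - z := by linarith
  have ha := neg_log_le h0 h1.le
  have hb := neg_log_le h2 (by linarith)
  rw [sub_sub_cancel] at hb
  have hz : 0 < √z := Real.sqrt_pos.2 h0
  have hz' : 0 < √(1 - z) := Real.sqrt_pos.2 h2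
  have h3 : Real.log z * Real.log (1 - z) ≤ (1 - z) / √z * (z / √(1 - z)) := by
    rw [← neg_mul_neg]
    exact mul_le_mul ha hb (by linarith [Real.log_nonpos h2.le (by linarith)]) (by positivity)
  have h4 : (1 - z) / √z * (z / √(1 - z)) = √z * √(1 - z) := by
    rw [div_mul_div_comm, div_eq_iff (by positivity)]
    nlinarith [Real.mul_self_sqrt h0.le, Real.mul_self_sqrt h2.le]
  have h5 : (√z * √(1 - z)) ^ 2 = z * (1 - z) := by
    rw [mul_pow, Real.sq_sqrt h0.le, Real.sq_sqrt h2.le]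
  nlinarith [sq_nonneg (√z * √(1 - z) - 1 / 2)]

lemma integrableOn_log_pow_three :
    IntegrableOn (fun z => |Real.log z| ^ 3) (Ioo (0 : ℝ) 1) := by
  have h1 : IntegrableOn (fun z : ℝ => 216 * z ^ (-(1 / 2) : ℝ)) (Ioo (0 : ℝ) 1) := by
    have := (intervalIntegral.intervalIntegrable_rpow' (a := 0) (b := 1) (r := -(1 / 2))
      (by norm_num)).const_mul 216
    rw [intervalIntegrable_iff_integrableOn_Ioo_of_le zero_le_one] at this
    exact this
  refine Integrable.mono' h1 (by fun_prop) ?_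
  refine (ae_restrict_iff' measurableSet_Ioo).2 (Filter.Eventually.of_forall fun z hz => ?_)
  have h2 := (Real.abs_log_mul_self_rpow_lt z (1 / 6) hz.1 hz.2.le (by norm_num)).le
  have hp : 0 < z ^ (1 / 6 : ℝ) := Real.rpow_pos_of_pos hz.1 _
  rw [abs_mul, abs_of_pos hp] at h2
  have h3 : (z ^ (1 / 6 : ℝ)) ^ 3 * z ^ (-(1 / 2) : ℝ) = 1 := by
    rw [← Real.rpow_natCast, ← Real.rpow_mul hz.1.le, ← Real.rpow_add hz.1]
    norm_num
  have h4 : (|Real.log z| * z ^ (1 / 6 : ℝ)) ^ 3 ≤ 6 ^ 3 :=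
    pow_le_pow_left₀ (by positivity) (h2.trans (by norm_num)) 3
  have hq : 0 < z ^ (-(1 / 2) : ℝ) := Real.rpow_pos_of_pos hz.1 _
  rw [Real.norm_of_nonneg (by positivity)]
  calc |Real.log z| ^ 3 = (|Real.log z| * z ^ (1 / 6 : ℝ)) ^ 3 * z ^ (-(1 / 2) : ℝ) := by
        rw [mul_pow, mul_assoc, h3, mul_one]
    _ ≤ 6 ^ 3 * z ^ (-(1 / 2) : ℝ) := by gcongr
    _ = _ := by norm_num

lemma integrableOn_comp_one_sub {f : ℝ → ℝ} (hf : IntegrableOn f (Ioo (0 : ℝ) 1)) :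
    IntegrableOn (fun z => f (1 - z)) (Ioo (0 : ℝ) 1) := by
  rw [← intervalIntegrable_iff_integrableOn_Ioo_of_le zero_le_one] at hf ⊢
  simpa using (hf.comp_sub_left 1).symm

lemma abs_logWeight_pow_le (z : ℝ) :
    |logWeight z| ^ 3 ≤ 9 * (1 + |Real.log z| ^ 3 + |Real.log (1 - z)| ^ 3) := by
  set a := |Real.log z|
  set b := |Real.log (1 - z)|
  have ha : 0 ≤ a := abs_nonneg _
  have hb : 0 ≤ b := abs_nonneg _
  have h : |logWeight z| ≤ 1 + a + b := by
    unfold logWeight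
    have h1 := abs_sub (-1 - Real.log z) (Real.log (1 - z))
    have h2 := abs_sub (-1) (Real.log z)
    rw [abs_neg, abs_one] at h2
    linarith
  refine (pow_le_pow_left₀ (abs_nonneg _) h 3).trans ?_
  nlinarith [mul_nonneg ha hb, mul_nonneg (add_nonneg ha hb) (sq_nonneg (a - b)),
    mul_nonneg (add_nonneg zero_le_one ha) (sq_nonneg (a - 1)),
    mul_nonneg (add_nonneg zero_le_one hb) (sq_nonneg (b - 1)),
    mul_nonneg ha (sq_nonneg (b - 1)), mul_nonneg hb (sq_nonneg (a - 1)), sq_nonneg (a - b)]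

lemma integrableOn_logWeight_pow {n : ℕ} (hn : n ≤ 3) :
    IntegrableOn (fun z => logWeight z ^ n) (Ioo (0 : ℝ) 1) := by
  have h1 : IntegrableOn (fun z => 1 + 9 * (1 + |Real.log z| ^ 3 + |Real.log (1 - z)| ^ 3))
      (Ioo (0 : ℝ) 1) := by
    have hc : ∀ c : ℝ, IntegrableOn (fun _ => c) (Ioo (0 : ℝ) 1) := fun c =>
      integrableOn_const (by simp)
    exact (hc 1).add ((((hc 1).add integrableOn_log_pow_three).add
      (integrableOn_comp_one_sub integrableOn_log_pow_three)).const_mul 9)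
  refine Integrable.mono' h1 (measurable_logWeight.pow_const n).aestronglyMeasurable
    (Filter.Eventually.of_forall fun z => ?_)
  rw [norm_pow, Real.norm_eq_abs]
  refine le_trans ?_ (add_le_add_right (abs_logWeight_pow_le z) 1)
  rcases le_total |logWeight z| 1 with h | h
  · have := pow_le_one₀ (n := n) (abs_nonneg _) h
    have := pow_nonneg (abs_nonneg (logWeight z)) 3
    linarith
  · have := pow_le_pow_right₀ h hn
    linarith

lemma integrableOn_log : IntegrableOn Real.log (Ioo (0 : ℝ) 1) := by
  rw [← intervalIntegrable_iff_integrableOn_Ioo_of_le zero_le_one]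
  exact intervalIntegral.intervalIntegrable_log'

lemma integrableOn_log_sq : IntegrableOn (fun z => Real.log z ^ 2) (Ioo (0 : ℝ) 1) := by
  have hc : IntegrableOn (fun _ => (1 : ℝ)) (Ioo (0 : ℝ) 1) := integrableOn_const (by simp)
  refine Integrable.mono' (hc.add integrableOn_log_pow_three) (by fun_prop)
    (Filter.Eventually.of_forall fun z => ?_)
  rw [norm_pow, Real.norm_eq_abs, Pi.add_apply]
  have h0 := abs_nonneg (Real.log z)
  rcases le_total |Real.log z| 1 with h | h
  · have := pow_le_one₀ (n := 2) h0 h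
    have := pow_nonneg h0 3
    linarith
  · have := pow_le_pow_right₀ h (show 2 ≤ 3 by norm_num)
    linarith

lemma integral_log_sq : ∫ z in (0 : ℝ)..1, Real.log z ^ 2 = 2 := by
  have hcont : ContinuousOn (fun z : ℝ => z * Real.log z ^ 2 - 2 * (z * Real.log z) + 2 * z)
      (Icc 0 1) := by
    have h1 : Continuous fun z : ℝ => 4 * (√z * Real.log √z) ^ 2 :=
      ((Real.continuous_mul_log.comp Real.continuous_sqrt).pow 2).const_mul 4
    have h2 : ContinuousOn (fun z : ℝ => z * Real.log z ^ 2) (Icc 0 1) := by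
      refine h1.continuousOn.congr fun z hz => ?_
      simp only
      rw [Real.log_sqrt hz.1, mul_pow, Real.sq_sqrt hz.1]
      ring
    exact (h2.sub (Real.continuous_mul_log.const_mul 2).continuousOn).add (by fun_prop)
  have h := intervalIntegral.integral_eq_sub_of_hasDeriv_right_of_le zero_le_one hcont
    (f' := fun z => Real.log z ^ 2) (fun z hz => ?_)
    ((intervalIntegrable_iff_integrableOn_Ioo_of_le zero_le_one).2 integrableOn_log_sq)
  · rw [h]; norm_num
  · refine HasDerivAt.hasDerivWithinAt ?_
    have hz0 : z ≠ 0 := hz.1.ne'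
    have hl := Real.hasDerivAt_log hz0
    refine ((((hasDerivAt_id' z).fun_mul (hl.fun_pow 2)).fun_sub
      (((hasDerivAt_id' z).fun_mul hl).const_mul 2)).fun_add
      ((hasDerivAt_id' z).const_mul 2)).congr_deriv ?_
    field_simp
    ring

lemma setIntegral_Ioo_eq (f : ℝ → ℝ) : ∫ z in Ioo (0 : ℝ) 1, f z = ∫ z in (0 : ℝ)..1, f z := by
  rw [intervalIntegral.integral_of_le zero_le_one, integral_Ioc_eq_integral_Ioo]

lemma setIntegral_comp_one_sub (f : ℝ → ℝ) :
    ∫ z in Ioo (0 : ℝ) 1, f (1 - z) = ∫ z in Ioo (0 : ℝ) 1, f z := by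
  rw [setIntegral_Ioo_eq, setIntegral_Ioo_eq, intervalIntegral.integral_comp_sub_left]
  simp

/-- The exact value is `5 - π² / 3`. The bound `11 / 6` avoids the evaluation of
`∫ log z log (1 - z)` and still leaves `√(11 / 6) < 7 / 5`. -/
lemma integral_logWeight_sq_le : ∫ z in Ioo (0 : ℝ) 1, logWeight z ^ 2 ≤ 11 / 6 := by
  have hc : IntegrableOn (fun z : ℝ => 1 + 2 * (z * (1 - z) + 1 / 4)) (Ioo (0 : ℝ) 1) :=
    (Continuous.integrableOn_Icc (by fun_prop)).mono_set Ioo_subset_Icc_self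
  have hl := integrableOn_log.const_mul 2
  have hl' := integrableOn_comp_one_sub hl
  have hq := integrableOn_log_sq
  have hq' := integrableOn_comp_one_sub hq
  have e1 : ∫ z in Ioo (0 : ℝ) 1, 2 * Real.log z = -2 := by
    rw [setIntegral_Ioo_eq, intervalIntegral.integral_const_mul, integral_log]; norm_num
  have e2 : ∫ z in Ioo (0 : ℝ) 1, Real.log z ^ 2 = 2 := by
    rw [setIntegral_Ioo_eq, integral_log_sq]
  have e1' : ∫ z in Ioo (0 : ℝ) 1, 2 * Real.log (1 - z) = -2 := by
    rw [setIntegral_comp_one_sub fun z => 2 * Real.log z, e1]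
  have e2' : ∫ z in Ioo (0 : ℝ) 1, Real.log (1 - z) ^ 2 = 2 := by
    rw [setIntegral_comp_one_sub fun z => Real.log z ^ 2, e2]
  have e3 : ∫ z in Ioo (0 : ℝ) 1, (1 + 2 * (z * (1 - z) + 1 / 4)) = 11 / 6 := by
    rw [setIntegral_Ioo_eq]
    have : (fun z : ℝ => 1 + 2 * (z * (1 - z) + 1 / 4)) = fun z => 3 / 2 + (2 * z - 2 * z ^ 2) := by
      funext z; ring
    rw [this, intervalIntegral.integral_add (by simp) (Continuous.intervalIntegrable (by fun_prop) _ _),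
      intervalIntegral.integral_sub (Continuous.intervalIntegrable (by fun_prop) _ _)
        (Continuous.intervalIntegrable (by fun_prop) _ _)]
    rw [intervalIntegral.integral_const_mul, intervalIntegral.integral_const_mul, integral_id,
      integral_pow, intervalIntegral.integral_const]
    norm_num
  have i1 := integral_add hc hl
  have i2 := integral_add (hc.add hl) hl'
  have i3 := integral_add ((hc.add hl).add hl') hq
  have i4 := integral_add (((hc.add hl).add hl').add hq) hq'
  simp only [Pi.add_apply] at i1 i2 i3 i4
  calc ∫ z in Ioo (0 : ℝ) 1, logWeight z ^ 2
      ≤ ∫ z in Ioo (0 : ℝ) 1, ((1 + 2 * (z * (1 - z) + 1 / 4)) + 2 * Real.log z +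
          2 * Real.log (1 - z) + Real.log z ^ 2 + Real.log (1 - z) ^ 2) := by
        refine setIntegral_mono_on (integrableOn_logWeight_pow (by norm_num))
          ((((hc.add hl).add hl').add hq).add hq') measurableSet_Ioo fun z hz => ?_
        have := log_mul_log_le hz.1 hz.2
        unfold logWeight
        nlinarith
    _ = 11 / 6 := by
        rw [i4, i3, i2, i1, e1, e2, e1', e2', e3]
        norm_num

lemma logWeight_nonneg {z : ℝ} (h0 : 0 < z) (h1 : z < 1) : 0 ≤ logWeight z := by
  have h2 := Real.log_le_sub_one_of_pos h0
  have h3 := Real.log_le_sub_one_of_pos (sub_pos.2 h1)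
  unfold logWeight
  linarith

/-! ### Functions on `(0,1)` with finite weighted Dirichlet energy -/

/-- A bounded function `w` on `(0,1)` which is a primitive of `γ`, where
`∫ z (1 - z) γ(z)² dz < ∞`. -/
structure IsWeightedPrimitive (w γ : ℝ → ℝ) : Prop where
  meas : Measurable w
  meas_deriv : Measurable γ
  bdd : ∃ B, ∀ z, |w z| ≤ B
  int : IntegrableOn (fun z => z * (1 - z) * γ z ^ 2) (Ioo 0 1)
  line : ∀ᵐ q ∂((volume.restrict (Ioo (0 : ℝ) 1)).prod (volume.restrict (Ioo (0 : ℝ) 1))),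
    w q.2 - w q.1 = ∫ t in q.1..q.2, γ t

instance : IsProbabilityMeasure (volume.restrict (Ioo (0 : ℝ) 1)) := ⟨by simp⟩

lemma lintegral_Ioo_ofReal {a b : ℝ} (hab : a ≤ b) {f : ℝ → ℝ}
    (hf : IntegrableOn f (Ioo a b)) (h0 : ∀ z ∈ Ioo a b, 0 ≤ f z) :
    ∫⁻ z in Ioo a b, ENNReal.ofReal (f z) = ENNReal.ofReal (∫ z in a..b, f z) := by
  rw [intervalIntegral.integral_of_le hab, integral_Ioc_eq_integral_Ioo,
    ofReal_integral_eq_lintegral_ofReal hf ((ae_restrict_iff' measurableSet_Ioo).2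
      (Filter.Eventually.of_forall h0))]

lemma lintegral_Ioo_split {t : ℝ} (ht : t ∈ Ioo (0 : ℝ) 1) (F : ℝ → ℝ≥0∞) :
    ∫⁻ y in Ioo 0 1, F y = (∫⁻ y in Ioo 0 t, F y) + ∫⁻ y in Ioo t 1, F y := by
  have h : Ioo (0 : ℝ) 1 = Ioo 0 t ∪ Ico t 1 := (Ioo_union_Ico_eq_Ioo ht.1 ht.2.le).symm
  rw [h, lintegral_union measurableSet_Ico]
  · congr 1
    exact setLIntegral_congr Ioo_ae_eq_Ico.symm
  · exact disjoint_left.2 fun y hy hy' => absurd hy.2 (not_lt.2 hy'.1)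

lemma uIoc_subset_Ioo {y z : ℝ} (hy : y ∈ Ioo (0 : ℝ) 1) (hz : z ∈ Ioo (0 : ℝ) 1) :
    uIoc y z ⊆ Ioo 0 1 := fun _ ht =>
  ⟨(lt_min hy.1 hz.1).trans ht.1, ht.2.trans_lt (max_lt hy.2 hz.2)⟩

lemma lintegral_uIoc_eq {y z : ℝ} (hy : y ∈ Ioo (0 : ℝ) 1) (hz : z ∈ Ioo (0 : ℝ) 1)
    (F : ℝ → ℝ≥0∞) :
    ∫⁻ t in uIoc y z, F t = ∫⁻ t in Ioo 0 1, (uIoc y z).indicator 1 t * F t := by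
  have h : ∀ t, (uIoc y z).indicator 1 t * F t = (uIoc y z).indicator F t := fun t => by
    by_cases ht : t ∈ uIoc y z <;> simp [ht]
  simp only [h]
  rw [setLIntegral_indicator measurableSet_uIoc, inter_eq_left.2 (uIoc_subset_Ioo hy hz)]

lemma measurable_indicator_uIoc :
    Measurable fun r : (ℝ × ℝ) × ℝ => (uIoc r.1.1 r.1.2).indicator (1 : ℝ → ℝ≥0∞) r.2 := by
  have h : (fun r : (ℝ × ℝ) × ℝ => (uIoc r.1.1 r.1.2).indicator (1 : ℝ → ℝ≥0∞) r.2) =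
      {r : (ℝ × ℝ) × ℝ | min r.1.1 r.1.2 < r.2 ∧ r.2 ≤ max r.1.1 r.1.2}.indicator 1 := by
    funext r; rfl
  rw [h]
  have h1 : Measurable fun r : (ℝ × ℝ) × ℝ => min r.1.1 r.1.2 := by fun_prop
  have h2 : Measurable fun r : (ℝ × ℝ) × ℝ => max r.1.1 r.1.2 := by fun_prop
  exact measurable_one.indicator ((measurableSet_lt h1 measurable_snd).inter
    (measurableSet_le measurable_snd h2))

lemma ae_prod_mem_Ioo :
    ∀ᵐ q ∂((volume.restrict (Ioo (0 : ℝ) 1)).prod (volume.restrict (Ioo (0 : ℝ) 1))),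
      q.1 ∈ Ioo (0 : ℝ) 1 ∧ q.2 ∈ Ioo (0 : ℝ) 1 := by
  rw [Measure.prod_restrict]
  exact ae_restrict_mem (measurableSet_Ioo.prod measurableSet_Ioo)

/-- `∬ |y - z| dy dz`, over the pairs `(y, z)` separated by `t`, is `t (1 - t)`. -/
lemma lintegral_abs_sub_separated {t : ℝ} (ht : t ∈ Ioo (0 : ℝ) 1) :
    ∫⁻ q, ENNReal.ofReal |q.2 - q.1| * (uIoc q.1 q.2).indicator 1 t
      ∂((volume.restrict (Ioo (0 : ℝ) 1)).prod (volume.restrict (Ioo (0 : ℝ) 1))) =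
      ENNReal.ofReal (t * (1 - t)) := by
  have hci : ∀ (a b : ℝ) (f : ℝ → ℝ), Continuous f → IntegrableOn f (Ioo a b) := fun a b f hf =>
    hf.integrableOn_Icc.mono_set Ioo_subset_Icc_self
  have hK : Measurable fun q : ℝ × ℝ => ENNReal.ofReal |q.2 - q.1| *
      (uIoc q.1 q.2).indicator (1 : ℝ → ℝ≥0∞) t :=
    (ENNReal.measurable_ofReal.comp (by fun_prop)).mul
      (measurable_indicator_uIoc.comp (f := fun q : ℝ × ℝ => (q, t)) (by fun_prop))
  rw [lintegral_prod _ hK.aemeasurable, lintegral_Ioo_split ht]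
  have h1 : ∀ y ∈ Ioo 0 t, ∫⁻ z in Ioo (0 : ℝ) 1,
      ENNReal.ofReal |z - y| * (uIoc y z).indicator 1 t =
      ENNReal.ofReal ((1 - t) * ((1 + t) / 2 - y)) := by
    intro y hy
    rw [lintegral_Ioo_split ht]
    have e1 : ∫⁻ z in Ioo (0 : ℝ) t, ENNReal.ofReal |z - y| * (uIoc y z).indicator 1 t = 0 := by
      rw [setLIntegral_congr_fun (g := fun _ => 0) measurableSet_Ioo, lintegral_zero]
      intro z hz
      have : t ∉ uIoc y z := fun h => absurd (max_lt hy.2 hz.2) (not_lt.2 h.2)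
      simp [this]
    have e2 : ∫⁻ z in Ioo t 1, ENNReal.ofReal |z - y| * (uIoc y z).indicator 1 t =
        ∫⁻ z in Ioo t 1, ENNReal.ofReal (z - y) := by
      refine setLIntegral_congr_fun measurableSet_Ioo fun z hz => ?_
      have : t ∈ uIoc y z := ⟨min_lt_of_left_lt hy.2, le_max_of_le_right hz.1.le⟩
      rw [indicator_of_mem this, abs_of_nonneg (by linarith [hy.2, hz.1]), Pi.one_apply, mul_one]
    rw [e1, e2, zero_add, lintegral_Ioo_ofReal ht.2.le (hci _ _ _ (by fun_prop))
      fun z hz => by linarith [hy.2, hz.1]]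
    rw [intervalIntegral.integral_sub (by simp) (by simp), integral_id]
    congr 1
    simp
    ring
  have h2 : ∀ y ∈ Ioo t 1, ∫⁻ z in Ioo (0 : ℝ) 1,
      ENNReal.ofReal |z - y| * (uIoc y z).indicator 1 t =
      ENNReal.ofReal (t * (y - t / 2)) := by
    intro y hy
    rw [lintegral_Ioo_split ht]
    have e1 : ∫⁻ z in Ioo t 1, ENNReal.ofReal |z - y| * (uIoc y z).indicator 1 t = 0 := by
      rw [setLIntegral_congr_fun (g := fun _ => 0) measurableSet_Ioo, lintegral_zero]
      intro z hz
      have : t ∉ uIoc y z := fun h => absurd (lt_min hy.1 hz.1) (not_lt.2 h.1.le)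
      simp [this]
    have e2 : ∫⁻ z in Ioo 0 t, ENNReal.ofReal |z - y| * (uIoc y z).indicator 1 t =
        ∫⁻ z in Ioo 0 t, ENNReal.ofReal (y - z) := by
      refine setLIntegral_congr_fun measurableSet_Ioo fun z hz => ?_
      have : t ∈ uIoc y z := ⟨min_lt_of_right_lt hz.2, le_max_of_le_left hy.1.le⟩
      rw [indicator_of_mem this, abs_sub_comm, abs_of_nonneg (by linarith [hy.1, hz.2]),
        Pi.one_apply, mul_one]
    rw [e1, e2, add_zero, lintegral_Ioo_ofReal ht.1.le (hci _ _ _ (by fun_prop))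
      fun z hz => by linarith [hy.1, hz.2]]
    rw [intervalIntegral.integral_sub (by simp) (by simp), integral_id]
    congr 1
    simp
    ring
  rw [setLIntegral_congr_fun measurableSet_Ioo h1, setLIntegral_congr_fun measurableSet_Ioo h2,
    lintegral_Ioo_ofReal ht.1.le (hci _ _ _ (by fun_prop)) fun y hy =>
      mul_nonneg (by linarith [ht.2]) (by linarith [ht.2, hy.2]),
    lintegral_Ioo_ofReal ht.2.le (hci _ _ _ (by fun_prop)) fun y hy =>
      mul_nonneg ht.1.le (by linarith [ht.1, hy.1]),
    intervalIntegral.integral_const_mul, intervalIntegral.integral_const_mul,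
    intervalIntegral.integral_sub (by simp) (by simp),
    intervalIntegral.integral_sub (by simp) (by simp), integral_id, integral_id,
    intervalIntegral.integral_const, intervalIntegral.integral_const, smul_eq_mul, smul_eq_mul,
    ← ENNReal.ofReal_add]
  · congr 1; ring
  · nlinarith [mul_pos ht.1 (sub_pos.2 ht.2)]
  · nlinarith [mul_pos ht.1 (sub_pos.2 ht.2)]

namespace IsWeightedPrimitive

variable {w γ : ℝ → ℝ}

lemma integrable_comp (h : IsWeightedPrimitive w γ) {F : ℝ → ℝ} (hF : Continuous F) :
    Integrable (fun z => F (w z)) (volume.restrict (Ioo (0 : ℝ) 1)) := by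
  obtain ⟨B, hB⟩ := h.bdd
  obtain ⟨C, hC⟩ := (isCompact_Icc (a := -B) (b := B)).exists_bound_of_continuousOn hF.continuousOn
  exact Integrable.of_bound (hF.measurable.comp h.meas).aestronglyMeasurable C
    (Filter.Eventually.of_forall fun z => hC _ (abs_le.1 (hB z)))

lemma lintegral_energy (h : IsWeightedPrimitive w γ) :
    ∫⁻ z in Ioo 0 1, ENNReal.ofReal (z * (1 - z)) * ENNReal.ofReal (γ z ^ 2) =
      ENNReal.ofReal (∫ z in Ioo 0 1, z * (1 - z) * γ z ^ 2) := by
  have h0 : ∀ z ∈ Ioo (0 : ℝ) 1, 0 ≤ z * (1 - z) := fun z hz =>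
    mul_nonneg hz.1.le (sub_nonneg.2 hz.2.le)
  rw [ofReal_integral_eq_lintegral_ofReal h.int ((ae_restrict_iff' measurableSet_Ioo).2
    (Filter.Eventually.of_forall fun z hz => mul_nonneg (h0 z hz) (sq_nonneg _)))]
  exact setLIntegral_congr_fun measurableSet_Ioo fun z hz =>
    (ENNReal.ofReal_mul (h0 z hz)).symm

/-- The sharp weighted Poincaré inequality on `(0,1)`: average
`(w z - w y)² ≤ |z - y| ∫_y^z γ²` over all pairs `y, z`. -/
lemma variance_le (h : IsWeightedPrimitive w γ) :
    2 * ((∫ z in Ioo 0 1, w z ^ 2) - (∫ z in Ioo 0 1, w z) ^ 2) ≤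
      ∫ z in Ioo 0 1, z * (1 - z) * γ z ^ 2 := by
  set μ := volume.restrict (Ioo (0 : ℝ) 1) with hμ
  have hw := h.integrable_comp continuous_id
  have hw2 := h.integrable_comp (F := fun x => x ^ 2) (by fun_prop)
  have i1 : Integrable (fun q : ℝ × ℝ => w q.2 ^ 2) (μ.prod μ) := hw2.comp_snd _
  have i2 : Integrable (fun q : ℝ × ℝ => w q.1 ^ 2) (μ.prod μ) := hw2.comp_fst _
  have i3 : Integrable (fun q : ℝ × ℝ => 2 * (w q.1 * w q.2)) (μ.prod μ) :=
    (hw.mul_prod hw).const_mul 2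
  have e : ∀ q : ℝ × ℝ, (w q.2 - w q.1) ^ 2 = w q.2 ^ 2 + w q.1 ^ 2 - 2 * (w q.1 * w q.2) :=
    fun q => by ring
  have hint : Integrable (fun q : ℝ × ℝ => (w q.2 - w q.1) ^ 2) (μ.prod μ) := by
    simp only [e]; exact (i1.add i2).sub i3
  have hval : ∫ q, (w q.2 - w q.1) ^ 2 ∂(μ.prod μ) =
      2 * ((∫ z, w z ^ 2 ∂μ) - (∫ z, w z ∂μ) ^ 2) := by
    have j1 := integral_sub (i1.add i2) i3
    simp only [Pi.add_apply] at j1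
    simp only [e]
    rw [j1, integral_add i1 i2, integral_const_mul, integral_prod_mul,
      integral_fun_snd (fun z => w z ^ 2), integral_fun_fst (fun z => w z ^ 2)]
    simp
    ring
  have hm : Measurable fun r : (ℝ × ℝ) × ℝ => ENNReal.ofReal |r.1.2 - r.1.1| *
      (uIoc r.1.1 r.1.2).indicator 1 r.2 := (ENNReal.measurable_ofReal.comp (by fun_prop)).mul
        measurable_indicator_uIoc
  have hγ : Measurable fun t => ENNReal.ofReal (γ t ^ 2) :=
    ENNReal.measurable_ofReal.comp (h.meas_deriv.pow_const 2)
  have key : ENNReal.ofReal (2 * ((∫ z, w z ^ 2 ∂μ) - (∫ z, w z ∂μ) ^ 2)) ≤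
      ENNReal.ofReal (∫ z, z * (1 - z) * γ z ^ 2 ∂μ) := by
    calc ENNReal.ofReal (2 * ((∫ z, w z ^ 2 ∂μ) - (∫ z, w z ∂μ) ^ 2))
        = ∫⁻ q, ENNReal.ofReal ((w q.2 - w q.1) ^ 2) ∂(μ.prod μ) := by
          rw [← hval, ofReal_integral_eq_lintegral_ofReal hint
            (Filter.Eventually.of_forall fun q => sq_nonneg _)]
      _ ≤ ∫⁻ q, ∫⁻ t, ENNReal.ofReal |q.2 - q.1| * (uIoc q.1 q.2).indicator 1 t *
            ENNReal.ofReal (γ t ^ 2) ∂μ ∂(μ.prod μ) := by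
          refine lintegral_mono_ae ?_
          filter_upwards [h.line, ae_prod_mem_Ioo] with q hq hm
          simp only [mul_assoc]
          rw [lintegral_const_mul' _ _ ENNReal.ofReal_ne_top, ← lintegral_uIoc_eq hm.1 hm.2, hq,
            ← sq_abs, intervalIntegral.abs_integral_eq_abs_integral_uIoc, sq_abs]
          refine (ofReal_sq_integral_le h.meas_deriv.aemeasurable).trans ?_
          rw [Measure.restrict_apply_univ, Real.volume_uIoc]
      _ = ∫⁻ t, ∫⁻ q, ENNReal.ofReal |q.2 - q.1| * (uIoc q.1 q.2).indicator 1 t *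
            ENNReal.ofReal (γ t ^ 2) ∂(μ.prod μ) ∂μ :=
          lintegral_lintegral_swap (hm.mul (hγ.comp measurable_snd)).aemeasurable
      _ = ∫⁻ t, ENNReal.ofReal (t * (1 - t)) * ENNReal.ofReal (γ t ^ 2) ∂μ := by
          refine setLIntegral_congr_fun measurableSet_Ioo fun t ht => ?_
          rw [lintegral_mul_const' _ _ ENNReal.ofReal_ne_top, lintegral_abs_sub_separated ht]
      _ = _ := h.lintegral_energy
  refine (ENNReal.ofReal_le_ofReal_iff ?_).1 key
  exact setIntegral_nonneg measurableSet_Ioo fun z hz =>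
    mul_nonneg (mul_nonneg hz.1.le (sub_nonneg.2 hz.2.le)) (sq_nonneg _)

end IsWeightedPrimitive

/-! ### The pointwise oscillation and the moments -/

lemma lintegral_indicator_uIoc {z t : ℝ} (ht : t ∈ Ioo (0 : ℝ) 1) :
    ∫⁻ y in Ioo (0 : ℝ) 1, (uIoc z y).indicator 1 t =
      ENNReal.ofReal (if t ≤ z then t else 1 - t) := by
  rw [lintegral_Ioo_split ht]
  split_ifs with h
  · have e1 : ∫⁻ y in Ioo 0 t, (uIoc z y).indicator (1 : ℝ → ℝ≥0∞) t = ∫⁻ y in Ioo 0 t, 1 := by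
      refine setLIntegral_congr_fun measurableSet_Ioo fun y hy => ?_
      have : t ∈ uIoc z y := ⟨min_lt_of_right_lt hy.2, le_max_of_le_left h⟩
      simp [this]
    have e2 : ∫⁻ y in Ioo t 1, (uIoc z y).indicator (1 : ℝ → ℝ≥0∞) t = ∫⁻ y in Ioo t 1, 0 := by
      refine setLIntegral_congr_fun measurableSet_Ioo fun y hy => ?_
      have : t ∉ uIoc z y := fun h' => absurd (le_min h hy.1.le) (not_le.2 h'.1)
      simp [this]
    rw [e1, e2]; simp
  · rw [not_le] at h
    have e1 : ∫⁻ y in Ioo 0 t, (uIoc z y).indicator (1 : ℝ → ℝ≥0∞) t = ∫⁻ y in Ioo 0 t, 0 := by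
      refine setLIntegral_congr_fun measurableSet_Ioo fun y hy => ?_
      have : t ∉ uIoc z y := fun h' => absurd (max_lt h hy.2) (not_lt.2 h'.2)
      simp [this]
    have e2 : ∫⁻ y in Ioo t 1, (uIoc z y).indicator (1 : ℝ → ℝ≥0∞) t = ∫⁻ y in Ioo t 1, 1 := by
      refine setLIntegral_congr_fun measurableSet_Ioo fun y hy => ?_
      have : t ∈ uIoc z y := ⟨min_lt_of_left_lt h, le_max_of_le_right hy.1.le⟩
      simp [this]
    rw [e1, e2]; simp

/-- The weight `logWeight` in terms of the absolute value of the kernel of `w ↦ w - ∫ w`. -/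
lemma lintegral_kernel_sq {z : ℝ} (hz : z ∈ Ioo (0 : ℝ) 1) :
    ∫⁻ t in Ioo (0 : ℝ) 1, ENNReal.ofReal ((if t ≤ z then t else 1 - t) ^ 2 / (t * (1 - t))) =
      ENNReal.ofReal (logWeight z) := by
  rw [lintegral_Ioo_split hz]
  have c1 : ContinuousOn (fun t : ℝ => t / (1 - t)) (Icc 0 z) :=
    continuousOn_id.div (by fun_prop) fun t ht => by linarith [ht.2, hz.2]
  have c2 : ContinuousOn (fun t : ℝ => (1 - t) / t) (Icc z 1) :=
    ContinuousOn.div (by fun_prop) continuousOn_id fun t ht => by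
      have := hz.1.trans_le ht.1
      exact this.ne'
  have e1 : ∫⁻ t in Ioo 0 z, ENNReal.ofReal ((if t ≤ z then t else 1 - t) ^ 2 / (t * (1 - t))) =
      ∫⁻ t in Ioo 0 z, ENNReal.ofReal (t / (1 - t)) := by
    refine setLIntegral_congr_fun measurableSet_Ioo fun t ht => ?_
    have h0 : t ≠ 0 := ht.1.ne'
    rw [if_pos ht.2.le, sq, mul_div_mul_left _ _ h0]
  have e2 : ∫⁻ t in Ioo z 1, ENNReal.ofReal ((if t ≤ z then t else 1 - t) ^ 2 / (t * (1 - t))) =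
      ∫⁻ t in Ioo z 1, ENNReal.ofReal ((1 - t) / t) := by
    refine setLIntegral_congr_fun measurableSet_Ioo fun t ht => ?_
    have h0 : 1 - t ≠ 0 := (sub_pos.2 ht.2).ne'
    rw [if_neg (not_le.2 ht.1), sq, mul_div_mul_right _ _ h0]
  rw [e1, e2, lintegral_Ioo_ofReal hz.1.le
      (c1.integrableOn_Icc.mono_set Ioo_subset_Icc_self)
      fun t ht => div_nonneg ht.1.le (by linarith [ht.2, hz.2]),
    lintegral_Ioo_ofReal hz.2.le (c2.integrableOn_Icc.mono_set Ioo_subset_Icc_self)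
      fun t ht => div_nonneg (by linarith [ht.2]) (hz.1.trans ht.1).le]
  have v1 : ∫ t in (0 : ℝ)..z, t / (1 - t) = -z - Real.log (1 - z) := by
    rw [intervalIntegral.integral_eq_sub_of_hasDerivAt (f := fun t => -t - Real.log (1 - t))
      (fun t ht => ?_) (c1.mono (by rw [uIcc_of_le hz.1.le])).intervalIntegrable]
    · simp
    · rw [uIcc_of_le hz.1.le] at ht
      have h0 : 1 - t ≠ 0 := (sub_pos.2 (ht.2.trans_lt hz.2)).ne'
      refine ((hasDerivAt_id' t).neg.sub (((hasDerivAt_id' t).const_sub 1).log h0)).congr_deriv ?_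
      field_simp
      ring
  have v2 : ∫ t in z..1, (1 - t) / t = -Real.log z - (1 - z) := by
    rw [intervalIntegral.integral_eq_sub_of_hasDerivAt (f := fun t => Real.log t - t)
      (fun t ht => ?_) (c2.mono (by rw [uIcc_of_le hz.2.le])).intervalIntegrable]
    · simp; ring
    · rw [uIcc_of_le hz.2.le] at ht
      have h0 : t ≠ 0 := (hz.1.trans_le ht.1).ne'
      refine ((Real.hasDerivAt_log h0).sub (hasDerivAt_id' t)).congr_deriv ?_
      field_simp
  have p1 : 0 ≤ -z - Real.log (1 - z) := by
    have := Real.log_le_sub_one_of_pos (sub_pos.2 hz.2); linarith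
  have p2 : 0 ≤ -Real.log z - (1 - z) := by
    have := Real.log_le_sub_one_of_pos hz.1; linarith
  rw [v1, v2, ← ENNReal.ofReal_add p1 p2]
  congr 1
  unfold logWeight
  ring

namespace IsWeightedPrimitive

variable {w γ : ℝ → ℝ}

/-- The oscillation of `w` is controlled pointwise: write `w z - ∫ w = ∫ k(z, t) γ(t) dt`, where
`k(z, t)` is `t` for `t < z` and `t - 1` for `t > z`, and apply the Cauchy–Schwarz inequality with
the weight `t (1 - t)`. -/
lemma ae_sq_sub_mean_le (h : IsWeightedPrimitive w γ) :
    ∀ᵐ z ∂(volume.restrict (Ioo (0 : ℝ) 1)), (w z - ∫ y in Ioo 0 1, w y) ^ 2 ≤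
      (∫ z in Ioo 0 1, z * (1 - z) * γ z ^ 2) * logWeight z := by
  set μ := volume.restrict (Ioo (0 : ℝ) 1) with hμ
  have hw := h.integrable_comp continuous_id
  simp only [id] at hw
  have h1 := Measure.ae_ae_of_ae_prod h.line
  have hD : 0 ≤ ∫ z in Ioo 0 1, z * (1 - z) * γ z ^ 2 := setIntegral_nonneg measurableSet_Ioo
    fun z hz => mul_nonneg (mul_nonneg hz.1.le (sub_nonneg.2 hz.2.le)) (sq_nonneg _)
  filter_upwards [h1, ae_restrict_mem measurableSet_Ioo] with z hz hzI
  refine (ENNReal.ofReal_le_ofReal_iff (mul_nonneg hD (logWeight_nonneg hzI.1 hzI.2))).1 ?_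
  rw [ENNReal.ofReal_mul hD, ← enorm_sq_eq_ofReal, ← enorm_neg, neg_sub]
  have e0 : (∫ y, w y ∂μ) - w z = ∫ y, (w y - w z) ∂μ := by
    rw [integral_sub hw (integrable_const _), integral_const]; simp [hμ]
  have hm : Measurable fun r : ℝ × ℝ => (uIoc z r.1).indicator (1 : ℝ → ℝ≥0∞) r.2 :=
    measurable_indicator_uIoc.comp (f := fun r : ℝ × ℝ => ((z, r.1), r.2)) (by fun_prop)
  have hγ : Measurable fun t => ‖γ t‖ₑ := h.meas_deriv.enorm
  have hk : Measurable fun t : ℝ => if t ≤ z then t else 1 - t :=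
    Measurable.ite measurableSet_Iic (by fun_prop) (by fun_prop)
  have step1 : ‖∫ y, (w y - w z) ∂μ‖ₑ ≤
      ∫⁻ t, (ENNReal.ofReal √(t * (1 - t)) * ‖γ t‖ₑ) *
        ENNReal.ofReal ((if t ≤ z then t else 1 - t) / √(t * (1 - t))) ∂μ := by
    calc ‖∫ y, (w y - w z) ∂μ‖ₑ ≤ ∫⁻ y, ‖w y - w z‖ₑ ∂μ := enorm_integral_le_lintegral_enorm _
      _ ≤ ∫⁻ y, ∫⁻ t, (uIoc z y).indicator 1 t * ‖γ t‖ₑ ∂μ ∂μ := by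
          refine lintegral_mono_ae ?_
          filter_upwards [hz, ae_restrict_mem measurableSet_Ioo] with y hy hyI
          rw [hy, ← lintegral_uIoc_eq hzI hyI, Real.enorm_eq_ofReal_abs,
            intervalIntegral.abs_integral_eq_abs_integral_uIoc, ← Real.enorm_eq_ofReal_abs]
          exact enorm_integral_le_lintegral_enorm _
      _ = ∫⁻ t, ∫⁻ y, (uIoc z y).indicator 1 t * ‖γ t‖ₑ ∂μ ∂μ :=
          lintegral_lintegral_swap (hm.mul (hγ.comp measurable_snd)).aemeasurable
      _ = _ := by
          refine setLIntegral_congr_fun measurableSet_Ioo fun t ht => ?_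
          have hr : 0 < √(t * (1 - t)) := Real.sqrt_pos.2 (mul_pos ht.1 (sub_pos.2 ht.2))
          rw [lintegral_mul_const' _ _ enorm_ne_top, lintegral_indicator_uIoc ht, mul_right_comm,
            ← ENNReal.ofReal_mul hr.le, mul_div_cancel₀ _ hr.ne']
  have step2 := sq_lintegral_mul_le (μ := μ)
    (f := fun t => ENNReal.ofReal √(t * (1 - t)) * ‖γ t‖ₑ)
    (g := fun t => ENNReal.ofReal ((if t ≤ z then t else 1 - t) / √(t * (1 - t))))
    ((ENNReal.measurable_ofReal.comp (by fun_prop)).mul hγ).aemeasurable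
    (ENNReal.measurable_ofReal.comp (hk.div (by fun_prop))).aemeasurable
  have e1 : ∫⁻ t, (ENNReal.ofReal √(t * (1 - t)) * ‖γ t‖ₑ) ^ 2 ∂μ =
      ENNReal.ofReal (∫ z in Ioo 0 1, z * (1 - z) * γ z ^ 2) := by
    rw [← h.lintegral_energy]
    refine setLIntegral_congr_fun measurableSet_Ioo fun t ht => ?_
    rw [mul_pow, enorm_sq_eq_ofReal, ← ENNReal.ofReal_pow (Real.sqrt_nonneg _),
      Real.sq_sqrt (mul_nonneg ht.1.le (sub_nonneg.2 ht.2.le))]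
  have e2 : ∫⁻ t, ENNReal.ofReal ((if t ≤ z then t else 1 - t) / √(t * (1 - t))) ^ 2 ∂μ =
      ENNReal.ofReal (logWeight z) := by
    rw [← lintegral_kernel_sq hzI]
    refine setLIntegral_congr_fun measurableSet_Ioo fun t ht => ?_
    have hk0 : 0 ≤ if t ≤ z then t else 1 - t := by
      split_ifs
      exacts [ht.1.le, sub_nonneg.2 ht.2.le]
    rw [← ENNReal.ofReal_pow (div_nonneg hk0 (Real.sqrt_nonneg _)), div_pow,
      Real.sq_sqrt (mul_nonneg ht.1.le (sub_nonneg.2 ht.2.le))]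
  rw [e1, e2] at step2
  rw [e0]
  exact (pow_le_pow_left' step1 2).trans step2

/-- The first three moments of `w`, with the bounds on the centred third moment which follow from
the pointwise estimate of the oscillation. -/
lemma moment_bounds (h : IsWeightedPrimitive w γ) {m s D : ℝ} (hm : m = ∫ z in Ioo 0 1, w z)
    (hs : s = (∫ z in Ioo 0 1, w z ^ 2) - m ^ 2)
    (hD : D = ∫ z in Ioo 0 1, z * (1 - z) * γ z ^ 2) :
    0 ≤ s ∧ 2 * s ≤ D ∧
    (∫ z in Ioo 0 1, |w z - m| ^ 3) ^ 2 ≤ 11 / 6 * s * D ^ 2 ∧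
    (∫ z in Ioo 0 1, |w z - m| ^ 3) ^ 4 ≤
      (∫ z in Ioo 0 1, logWeight z ^ 3) * s ^ 3 * D ^ 3 ∧
    ∫ z in Ioo 0 1, w z ^ 3 ≤ m ^ 3 + 3 * m * s + ∫ z in Ioo 0 1, |w z - m| ^ 3 := by
  set μ := volume.restrict (Ioo (0 : ℝ) 1) with hμ
  have hw := h.integrable_comp continuous_id
  simp only [id] at hw
  have hw2 := h.integrable_comp (F := fun x => x ^ 2) (by fun_prop)
  have hw3 := h.integrable_comp (F := fun x => x ^ 3) (by fun_prop)
  have hu1 := h.integrable_comp (F := fun x => (x - m) ^ 2) (by fun_prop)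
  have hu2 := h.integrable_comp (F := fun x => (x - m) ^ 3) (by fun_prop)
  have hu3 := h.integrable_comp (F := fun x => |x - m| ^ 3) (by fun_prop)
  have hu4 := h.integrable_comp (F := fun x => (x - m) ^ 4) (by fun_prop)
  have hmeas : Measurable fun z => w z - m := h.meas.sub_const m
  have hsu : s = ∫ z, (w z - m) ^ 2 ∂μ := by
    have e : ∀ z, (w z - m) ^ 2 = w z ^ 2 - 2 * m * w z + m ^ 2 := fun z => by ring
    have j1 := integral_add (hw2.sub (hw.const_mul (2 * m))) (integrable_const (m ^ 2))
    have j2 := integral_sub hw2 (hw.const_mul (2 * m))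
    simp only [Pi.sub_apply] at j1
    simp only [e]
    rw [j1, j2, integral_const_mul, ← hm, hs]
    simp
    ring
  have hD0 : 0 ≤ D := by
    rw [hD]
    exact setIntegral_nonneg measurableSet_Ioo
      fun z hz => mul_nonneg (mul_nonneg hz.1.le (sub_nonneg.2 hz.2.le)) (sq_nonneg _)
  have hs0 : 0 ≤ s := by rw [hsu]; exact integral_nonneg fun z => sq_nonneg _
  have hL : ∀ᵐ z ∂μ, (w z - m) ^ 2 ≤ D * logWeight z := by
    rw [hm, hD]; exact h.ae_sq_sub_mean_le
  have hL0 : ∀ᵐ z ∂μ, 0 ≤ logWeight z := by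
    filter_upwards [ae_restrict_mem measurableSet_Ioo] with z hz
    exact logWeight_nonneg hz.1 hz.2
  have l2 := integrableOn_logWeight_pow (n := 2) (by norm_num)
  have l3 := integrableOn_logWeight_pow (n := 3) le_rfl
  have l1 := integrableOn_logWeight_pow (n := 1) (by norm_num)
  simp only [pow_one] at l1
  obtain ⟨B, hB⟩ := h.bdd
  have hb : ∀ᵐ z ∂μ, ‖(w z - m) ^ 2‖ ≤ (B + |m|) ^ 2 := Filter.Eventually.of_forall fun z => by
    rw [norm_pow, Real.norm_eq_abs]
    exact pow_le_pow_left₀ (abs_nonneg _) ((abs_sub _ _).trans (add_le_add_left (hB z) _)) 2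
  have i1 : Integrable (fun z => logWeight z * (w z - m) ^ 2) μ :=
    l1.mul_bdd (hmeas.pow_const 2).aestronglyMeasurable hb
  have i2 : Integrable (fun z => logWeight z ^ 2 * (w z - m) ^ 2) μ :=
    l2.mul_bdd (hmeas.pow_const 2).aestronglyMeasurable hb
  set X := ∫ z, (w z - m) ^ 4 ∂μ with hX
  set Y := ∫ z, logWeight z * (w z - m) ^ 2 ∂μ with hY
  set A := ∫ z, |w z - m| ^ 3 ∂μ with hA
  have hX0 : 0 ≤ X := integral_nonneg fun z => by positivity
  have hY0 : 0 ≤ Y := integral_nonneg_of_ae (by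
    filter_upwards [hL0] with z hz using mul_nonneg hz (sq_nonneg _))
  have hXY : X ≤ D * Y := by
    rw [hX, hY, ← integral_const_mul]
    refine integral_mono_ae hu4 (i1.const_mul D) ?_
    filter_upwards [hL] with z hz
    have := mul_le_mul_of_nonneg_right hz (sq_nonneg (w z - m))
    nlinarith
  have hY2 : Y ^ 2 ≤ 11 / 6 * X := by
    have e : ∀ z, ((w z - m) ^ 2) ^ 2 = (w z - m) ^ 4 := fun z => by ring
    have := sq_integral_mul_le (μ := μ) measurable_logWeight.aemeasurable
      (hmeas.pow_const 2).aemeasurable l2 (by simpa only [e] using hu4)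
    simp only [e] at this
    exact this.trans (mul_le_mul_of_nonneg_right integral_logWeight_sq_le hX0)
  -- the two bounds above close up: `X² ≤ D² Y² ≤ (11/6) D² X`
  have hX2 : X ≤ 11 / 6 * D ^ 2 := by
    by_contra hlt
    push Not at hlt
    have hXpos : 0 < X := lt_of_le_of_lt (by positivity) hlt
    have h1 : X ^ 2 ≤ D ^ 2 * Y ^ 2 := by
      rw [← mul_pow]; exact pow_le_pow_left₀ hX0 hXY 2
    have h2 : X ^ 2 ≤ D ^ 2 * (11 / 6 * X) := h1.trans (by gcongr)
    nlinarith
  have hY3 : Y ^ 2 ≤ s * (D * ∫ z, logWeight z ^ 3 ∂μ) := by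
    have e : ∀ z, logWeight z * (w z - m) ^ 2 = (w z - m) * (logWeight z * (w z - m)) :=
      fun z => by ring
    have e' : ∀ z, (logWeight z * (w z - m)) ^ 2 = logWeight z ^ 2 * (w z - m) ^ 2 :=
      fun z => by ring
    have h1 := sq_integral_mul_le (μ := μ) (g := fun z => logWeight z * (w z - m))
      hmeas.aemeasurable
      (measurable_logWeight.mul hmeas).aemeasurable hu1 (by simpa only [e'] using i2)
    simp only [← e, e'] at h1
    rw [← hsu] at h1
    refine h1.trans (mul_le_mul_of_nonneg_left ?_ hs0)
    rw [← integral_const_mul]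
    refine integral_mono_ae i2 (l3.const_mul D) ?_
    filter_upwards [hL] with z hz
    have := mul_le_mul_of_nonneg_left hz (sq_nonneg (logWeight z))
    nlinarith
  have hA2 : A ^ 2 ≤ s * X := by
    have e : ∀ z, |w z - m| ^ 3 = |w z - m| * (w z - m) ^ 2 := fun z => by
      rw [← sq_abs (w z - m)]; ring
    have e' : ∀ z, ((w z - m) ^ 2) ^ 2 = (w z - m) ^ 4 := fun z => by ring
    have h1 := sq_integral_mul_le (μ := μ) (f := fun z => |w z - m|)
      hmeas.abs.aemeasurable (hmeas.pow_const 2).aemeasurable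
      (by simpa only [sq_abs] using hu1) (by simpa only [e'] using hu4)
    simp only [← e, e', sq_abs] at h1
    rwa [← hsu] at h1
  refine ⟨hs0, ?_, ?_, ?_, ?_⟩
  · have := h.variance_le
    rw [hs, hD, hm]
    exact this
  · calc A ^ 2 ≤ s * X := hA2
      _ ≤ s * (11 / 6 * D ^ 2) := by gcongr
      _ = _ := by ring
  · calc A ^ 4 = (A ^ 2) ^ 2 := by ring
      _ ≤ (s * X) ^ 2 := by gcongr
      _ ≤ (s * (D * Y)) ^ 2 := by gcongr
      _ = s ^ 2 * D ^ 2 * Y ^ 2 := by ring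
      _ ≤ s ^ 2 * D ^ 2 * (s * (D * ∫ z, logWeight z ^ 3 ∂μ)) := by gcongr
      _ = _ := by ring
  · have e : ∀ z, w z ^ 3 = (w z - m) ^ 3 + (3 * m * w z ^ 2 - 3 * m ^ 2 * w z + m ^ 3) :=
      fun z => by ring
    have j0 := (hw2.const_mul (3 * m)).sub (hw.const_mul (3 * m ^ 2))
    have j1 := integral_add hu2 (j0.add (integrable_const (m ^ 3)))
    have j2 := integral_add j0 (integrable_const (m ^ 3))
    have j3 := integral_sub (hw2.const_mul (3 * m)) (hw.const_mul (3 * m ^ 2))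
    simp only [Pi.sub_apply, Pi.add_apply] at j1 j2
    have e2 : ∫ z, w z ^ 2 ∂μ = s + m ^ 2 := by rw [hs]; ring
    have h3 : ∫ z, (w z - m) ^ 3 ∂μ ≤ A := integral_mono hu2 hu3 fun z => by
      simp only
      rw [← abs_pow]; exact le_abs_self _
    simp only [e]
    rw [j1, j2, j3, integral_const_mul, integral_const_mul, ← hm, e2]
    simp only [integral_const, probReal_univ, smul_eq_mul, one_mul]
    linarith

end IsWeightedPrimitive

/-! ### Estimates on a single slice -/

lemma mul_sqrt_bound {A s D : ℝ} (hD : 0 ≤ D) (hA2 : A ^ 2 ≤ 11 / 6 * s * D ^ 2) {r : ℝ}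
    (hr : 0 ≤ r) (hsr : 11 / 6 * s ≤ r ^ 2) : A ≤ r * D := by
  refine abs_le_of_sq_le_sq' ?_ (mul_nonneg hr hD) |>.2
  calc A ^ 2 ≤ 11 / 6 * s * D ^ 2 := hA2
    _ ≤ r ^ 2 * D ^ 2 := by gcongr
    _ = (r * D) ^ 2 := by ring

/-- Here `m` and `σ²` are the mean and the variance of a function with `L²` norm `h`, and `271 / 200`
is a rational number slightly above `√(11 / 6)`. The squares of the two sides are compared: with
`h² = m² + σ²`, their difference is `σ²` times a positive definite quartic form in `m`, `σ`. -/
lemma cubic_bound {m σ h : ℝ} (h0 : 0 ≤ h) (hh : h ^ 2 = m ^ 2 + σ ^ 2) :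
    m ^ 3 + 3 * m * σ ^ 2 + 2 * (271 / 200) * σ ^ 3 ≤ h ^ 3 + 14 / 5 * h * σ ^ 2 := by
  have e : h ^ 3 + 14 / 5 * h * σ ^ 2 = h * (m ^ 2 + 19 / 5 * σ ^ 2) := by
    rw [pow_succ h 2, hh]; ring
  rw [e]
  refine abs_le_of_sq_le_sq' ?_ (by positivity) |>.2
  rw [mul_pow, hh]
  have hQ : 0 ≤ 13 / 5 * m ^ 4 - 271 / 50 * m ^ 3 * σ + 326 / 25 * m ^ 2 * σ ^ 2 -
      813 / 50 * m * σ ^ 3 + 70959 / 10000 * σ ^ 4 := by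
    nlinarith [sq_nonneg (m ^ 2 - 271 / 260 * m * σ + 1 / 5 * σ ^ 2),
      sq_nonneg (σ * (m - 827 / 1000 * σ)), sq_nonneg (m * σ), sq_nonneg (σ ^ 2)]
  nlinarith [mul_nonneg (sq_nonneg σ) hQ]

/-- The one-dimensional inequality `∫ f³ ≤ h³ + (7/5) h D - (m₋)³` in terms of the moments of `f`:
`m` is the mean, `s` the variance, `h` the `L²` norm, and `A` bounds the centred third moment. The
constant `7/5` matters: it has to be smaller than `3/2`. -/
lemma third_moment_le {m s D A h : ℝ} (hs : 0 ≤ s) (h2 : 2 * s ≤ D)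
    (hA2 : A ^ 2 ≤ 11 / 6 * s * D ^ 2) (h0 : 0 ≤ h) (hh : h ^ 2 = m ^ 2 + s) :
    m ^ 3 + 3 * m * s + A ≤ h ^ 3 + 7 / 5 * h * D - max (-m) 0 ^ 3 := by
  have hD : 0 ≤ D := by linarith
  rcases le_total m 0 with hm | hm
  · have hA := mul_sqrt_bound hD hA2 (r := 7 / 5 * h) (by positivity)
      (by nlinarith [sq_nonneg m])
    rw [max_eq_left (by linarith)]
    have h3 : 0 ≤ h ^ 3 := by positivity
    nlinarith [mul_nonneg (neg_nonneg.2 hm) hs]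
  · obtain ⟨σ, hσ, rfl⟩ : ∃ σ, 0 ≤ σ ∧ s = σ ^ 2 := ⟨√s, Real.sqrt_nonneg s, (Real.sq_sqrt hs).symm⟩
    have hA := mul_sqrt_bound hD hA2 (r := 271 / 200 * σ) (by positivity) (by nlinarith)
    have hc := cubic_bound h0 hh
    have hσh : σ ≤ h := abs_le_of_sq_le_sq' (by nlinarith [sq_nonneg m]) h0 |>.2
    rw [max_eq_right (by linarith)]
    have : 0 ≤ (7 / 5 * h - 271 / 200 * σ) * (D - 2 * σ ^ 2) :=
      mul_nonneg (by linarith) (by linarith)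
    nlinarith

/-- The data of a slice `W(·, x')`: its mean `a`, second moment `b`, third moment `c`, absolute
third moment `e` and weighted Dirichlet energy `D`, with the relations between them; the number `A`
in `third` stands for the absolute centred third moment. The relation `abs_le` comes from
`|W| ≤ 1/ε`. -/
structure IsSliceMoments (ε a b c e D : ℝ) : Prop where
  sq_le : a ^ 2 ≤ b
  poincare : 2 * (b - a ^ 2) ≤ D
  third : ∃ A, 0 ≤ A ∧ A ^ 2 ≤ 11 / 6 * (b - a ^ 2) * D ^ 2 ∧
    A ^ 4 ≤ (∫ z in Ioo 0 1, logWeight z ^ 3) * (b - a ^ 2) ^ 3 * D ^ 3 ∧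
    1 + 3 * a + 3 * b + c ≤ (1 + a) ^ 3 + 3 * (1 + a) * (b - a ^ 2) + A ∧
    e ≤ 4 * (|a| ^ 3 + A)
  le_abs : c ≤ e
  abs_nonneg : 0 ≤ e
  abs_le : ε * e ≤ b

namespace IsSliceMoments

variable {ε a b c e D : ℝ}

lemma norm_sq_nonneg (H : IsSliceMoments ε a b c e D) : 0 ≤ 1 + 2 * a + b := by
  nlinarith [H.sq_le, sq_nonneg (1 + a)]

lemma energy_nonneg (H : IsSliceMoments ε a b c e D) : 0 ≤ D := by
  have := H.poincare
  have := H.sq_le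
  linarith

/-- The bound by the `L²` norm alone, which uses the bound `1/ε` for `|W|`. -/
lemma le_of_bdd (H : IsSliceMoments ε a b c e D) (hε : 0 < ε) (hε1 : ε < 1) {δ : ℝ}
    (hδ1 : δ ≤ 1 / 3) : b + 2 / 3 * c + δ * e ≤ 2 / ε * b := by
  have h1 : e ≤ b / ε := by rw [le_div_iff₀ hε]; linarith [H.abs_le]
  have hb : 0 ≤ b := (sq_nonneg a).trans H.sq_le
  have h2 : b ≤ b / ε := by rw [le_div_iff₀ hε]; nlinarith
  have h3 : 2 / ε * b = 2 * (b / ε) := by ring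
  rw [h3]
  nlinarith [H.le_abs, mul_le_mul_of_nonneg_right hδ1 H.abs_nonneg]

/-- The estimate of a slice when the constraint is almost satisfied: `h` is the `L²` norm of `1 + W`
on the slice and `hb` its average over all slices. A slice with `h ≤ 21/20` is estimated by
`third_moment_le`, on the other slices `h` is comparable to `h - hb`. The last term records that
the inequality is strict near `W = -2`. -/
lemma le_of_near_constraint (H : IsSliceMoments ε a b c e D) (hε : 0 < ε) (hε1 : ε < 1) {δ : ℝ}
    (hδ : 0 < δ) (hδ1 : δ ≤ 1 / 3) {hb θ : ℝ} (hhb : hb ≤ 201 / 200) (hθ : 0 ≤ θ) (hθ1 : θ ≤ 1) :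
    b + 2 / 3 * c + δ * e ≤ 11 / 10 * (√(1 + 2 * a + b) - 1) ^ 2 + (49 / 50 + 13 * δ) * D +
      9 * δ * b + 6000 / ε * (√(1 + 2 * a + b) - hb) ^ 2 - θ * (-(1 + a) / 2 - 1 / 6) := by
  have hq := H.norm_sq_nonneg
  have h0 : 0 ≤ √(1 + 2 * a + b) := Real.sqrt_nonneg _
  have hh : √(1 + 2 * a + b) ^ 2 = 1 + 2 * a + b := Real.sq_sqrt hq
  set h := √(1 + 2 * a + b) with hdef
  have hb0 : 0 ≤ b := (sq_nonneg a).trans H.sq_le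
  have hD := H.energy_nonneg
  have hb2 : b ≤ 2 * h ^ 2 + 2 := by nlinarith [H.sq_le, sq_nonneg (a + 2)]
  rcases le_total h (21 / 20) with hg | hg
  · obtain ⟨A, hA0, hA2, -, hc, he⟩ := H.third
    have hs : 0 ≤ b - a ^ 2 := sub_nonneg.2 H.sq_le
    have h3 := third_moment_le (m := 1 + a) hs H.poincare hA2 h0 (by rw [hh]; ring)
    have hh2 : h ^ 2 ≤ (21 / 20) ^ 2 := pow_le_pow_left₀ h0 hg 2
    have hA : A ≤ 14 / 5 * D := mul_sqrt_bound hD hA2 (by norm_num)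
      (by nlinarith [sq_nonneg a])
    have ha : |a| ≤ 21 / 10 := abs_le_of_sq_le_sq (by nlinarith [H.sq_le]) (by norm_num)
    have ha3 : |a| ^ 3 ≤ 21 / 10 * b := by
      have : |a| ^ 3 = |a| * a ^ 2 := by rw [← sq_abs a]; ring
      rw [this]
      exact mul_le_mul ha H.sq_le (sq_nonneg a) (by norm_num)
    have he' : e ≤ 9 * b + 13 * D := by linarith
    -- `t³ ≥ (3/4) t - 1/4` is the tangent line at `t = 1/2`
    have hm : θ * (-(1 + a) / 2 - 1 / 6) ≤ 2 / 3 * max (-(1 + a)) 0 ^ 3 := by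
      set t := max (-(1 + a)) 0 with ht
      have t0 : 0 ≤ t := le_max_right _ _
      have t1 : -(1 + a) ≤ t := le_max_left _ _
      have t3 : 3 / 4 * t - 1 / 4 ≤ t ^ 3 := by
        nlinarith [mul_nonneg (add_nonneg t0 zero_le_one) (sq_nonneg (t - 1 / 2))]
      have t4 : -(1 + a) / 2 - 1 / 6 ≤ 2 / 3 * t ^ 3 := by linarith
      have t5 : 0 ≤ 2 / 3 * t ^ 3 := by positivity
      exact (mul_le_mul_of_nonneg_left t4 hθ).trans (mul_le_of_le_one_left t5 hθ1)
    have hcube : 2 / 3 * h ^ 3 - h ^ 2 + 1 / 3 ≤ 11 / 10 * (h - 1) ^ 2 := by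
      nlinarith [mul_nonneg (sub_nonneg.2 hg) (sq_nonneg (h - 1)), sq_nonneg (h - 1)]
    -- the product `(2/3) (7/5) (21/20)` stays below `1`
    have hhD : 2 / 3 * (7 / 5 * h * D) ≤ 49 / 50 * D := by
      nlinarith [mul_le_mul_of_nonneg_right hg hD]
    have hrest : 0 ≤ 6000 / ε * (h - hb) ^ 2 := by positivity
    have hδe := mul_le_mul_of_nonneg_left he' hδ.le
    linarith
  -- now `h ≤ 25 (h - hb)`, because `h ≥ 21/20` and `hb ≤ 201/200`
  · have h1 := H.le_of_bdd hε hε1 hδ1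
    have h2 : h ^ 2 ≤ 625 * (h - hb) ^ 2 := by nlinarith
    have hm : -(1 + a) / 2 - 1 / 6 ≤ h / 2 := by
      have : -(1 + a) ≤ h := by
        refine (neg_le_abs _).trans (abs_le_of_sq_le_sq ?_ h0)
        nlinarith [H.sq_le]
      linarith
    have hm' : θ * (-(1 + a) / 2 - 1 / 6) ≤ h / 2 := by
      nlinarith [mul_le_mul_of_nonneg_left hm hθ]
    have h3 : 2 / ε * b ≤ 8 / ε * h ^ 2 := by
      have : 2 / ε * b ≤ 2 / ε * (4 * h ^ 2) := by gcongr; nlinarith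
      refine this.trans (le_of_eq (by ring))
    have h4 : h / 2 ≤ 1 / ε * h ^ 2 := by
      have : 1 ≤ 1 / ε := by rw [le_div_iff₀ hε]; linarith
      nlinarith [sq_nonneg h]
    have h5 : 9 / ε * h ^ 2 ≤ 6000 / ε * (h - hb) ^ 2 := by
      have : 9 / ε * h ^ 2 ≤ 9 / ε * (625 * (h - hb) ^ 2) := by gcongr
      have h6 : 9 / ε * (625 * (h - hb) ^ 2) = 5625 / ε * (h - hb) ^ 2 := by ring
      have h7 : 5625 / ε * (h - hb) ^ 2 ≤ 6000 / ε * (h - hb) ^ 2 := by gcongr; norm_num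
      linarith
    have h8 : 9 / ε * h ^ 2 = 8 / ε * h ^ 2 + 1 / ε * h ^ 2 := by ring
    have h9 : 0 ≤ 11 / 10 * (h - 1) ^ 2 := by positivity
    have h10 : 0 ≤ (49 / 50 + 13 * δ) * D := by positivity
    have h11 : 0 ≤ 9 * δ * b := by positivity
    linarith

/-- The estimate of a slice without the constraint, with an arbitrarily large constant but only a
fraction of the energy: `k = √b` is the `L²` norm of `W` on the slice and `kb` its average. -/
lemma le_of_far (H : IsSliceMoments ε a b c e D) (hε : 0 < ε) (hε1 : ε < 1) {δ : ℝ}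
    (hδ1 : δ ≤ 1 / 3) {kb M : ℝ} (hM : 0 < M) (hkb : kb ^ 2 ≤ M)
    (hL : 0 ≤ ∫ z in Ioo 0 1, logWeight z ^ 3) :
    b + 2 / 3 * c + δ * e ≤
      (4 * M + 4 * (1 + 16 * M ^ 2) + 4096 * ((∫ z in Ioo 0 1, logWeight z ^ 3) * (4 * M) ^ 3)) +
        D / 4 + 8 / ε * (√b - kb) ^ 2 := by
  set L := ∫ z in Ioo 0 1, logWeight z ^ 3 with hLdef
  have hb0 : 0 ≤ b := (sq_nonneg a).trans H.sq_le
  have hD := H.energy_nonneg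
  have k0 : 0 ≤ √b := Real.sqrt_nonneg _
  have hk : √b ^ 2 = b := Real.sq_sqrt hb0
  set k := √b with hkdef
  rcases le_total b (4 * M) with hg | hg
  · obtain ⟨A, hA0, -, hA4, -, he⟩ := H.third
    have hs : 0 ≤ b - a ^ 2 := sub_nonneg.2 H.sq_le
    have hs' : b - a ^ 2 ≤ 4 * M := by nlinarith [sq_nonneg a]
    have hC : 0 ≤ L * (4 * M) ^ 3 := by positivity
    have hA : A ≤ D / 16 + 1024 * (L * (4 * M) ^ 3) := by
      set C := 1024 * (L * (4 * M) ^ 3) with hCdef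
      have hC0 : 0 ≤ C := by positivity
      refine le_of_pow_le_pow_left₀ (n := 4) (by norm_num) (by positivity) ?_
      calc A ^ 4 ≤ L * (b - a ^ 2) ^ 3 * D ^ 3 := hA4
        _ ≤ L * (4 * M) ^ 3 * D ^ 3 := by gcongr
        _ = 4 * (D / 16) ^ 3 * C := by rw [hCdef]; ring
        _ ≤ (D / 16 + C) ^ 4 := by
          have hx : 0 ≤ D / 16 := by positivity
          have : (D / 16 + C) ^ 4 - 4 * (D / 16) ^ 3 * C = (D / 16) ^ 4 + 6 * (D / 16) ^ 2 * C ^ 2 +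
            4 * (D / 16) * C ^ 3 + C ^ 4 := by ring
          have h2 : 0 ≤ (D / 16) ^ 4 + 6 * (D / 16) ^ 2 * C ^ 2 +
            4 * (D / 16) * C ^ 3 + C ^ 4 := by positivity
          linarith
    have ha3 : |a| ^ 3 ≤ 1 + 16 * M ^ 2 := by
      have h1 : |a| ^ 2 ≤ 4 * M := by rw [sq_abs]; linarith [H.sq_le]
      have h2 : |a| ^ 4 ≤ 16 * M ^ 2 := by
        calc |a| ^ 4 = (|a| ^ 2) ^ 2 := by ring
          _ ≤ (4 * M) ^ 2 := by gcongr
          _ = _ := by ring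
      have h3 : |a| ^ 3 ≤ 1 + |a| ^ 4 := by
        rcases le_total |a| 1 with h | h
        · have := pow_le_one₀ (n := 3) (_root_.abs_nonneg a) h
          have := pow_nonneg (_root_.abs_nonneg a) 4
          linarith
        · have := pow_le_pow_right₀ h (show 3 ≤ 4 by norm_num)
          linarith
      linarith
    have hrest : 0 ≤ 8 / ε * (k - kb) ^ 2 := by positivity
    have hce : 2 / 3 * c + δ * e ≤ e := by
      nlinarith [H.le_abs, mul_le_mul_of_nonneg_right hδ1 H.abs_nonneg]
    linarith
  -- now `kb ≤ √M ≤ k / 2`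
  · have h1 := H.le_of_bdd hε hε1 hδ1
    have hkk : 2 * kb ≤ k := by
      by_contra hlt
      push Not at hlt
      nlinarith
    have h2 : b ≤ 4 * (k - kb) ^ 2 := by
      rw [← hk]
      nlinarith
    have h3 : 2 / ε * b ≤ 8 / ε * (k - kb) ^ 2 := by
      have : 2 / ε * b ≤ 2 / ε * (4 * (k - kb) ^ 2) := by gcongr
      refine this.trans (le_of_eq (by ring))
    have h4 : 0 ≤ 4 * M + 4 * (1 + 16 * M ^ 2) + 4096 * (L * (4 * M) ^ 3) := by positivity
    linarith

end IsSliceMoments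

/-! ### Integration over the slices -/

lemma sq_sub_one_le {x : ℝ} (hx : 0 ≤ x) : (x - 1) ^ 2 ≤ (x ^ 2 - 1) ^ 2 := by
  have : (x ^ 2 - 1) ^ 2 - (x - 1) ^ 2 = (x - 1) ^ 2 * (x * (x + 2)) := by ring
  have h2 : 0 ≤ (x - 1) ^ 2 * (x * (x + 2)) := by positivity
  linarith

lemma dist_one_sq_le {x E V : ℝ} (hx : 0 ≤ x) (hV : 0 ≤ V) (hxV : x ^ 2 = 1 + E - V)
    (hE : E ≤ 1 / 100) : (x - 1) ^ 2 ≤ 2 * E ^ 2 + 3 * V := by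
  have h1 := sq_sub_one_le hx
  have h2 : V ≤ 101 / 100 := by nlinarith [sq_nonneg x]
  have h3 : (x ^ 2 - 1) ^ 2 = (E - V) ^ 2 := by rw [hxV]; ring
  nlinarith [sq_nonneg (E + V), mul_nonneg hV (sub_nonneg.2 h2)]

/-- The conclusion when the constraint `E = ∫ W² + 2 ∫ W = 0` is almost satisfied; here `B`, `A` are
`∫ W²` and `∫ W`, and `V`, `v` the variances of the slice norm of `1 + W` and of `W`. Only the
terms with `δ * B` need care: if the mean `1 + A` of `1 + W` is nonnegative, `B` is bounded by
multiples of `E²` and `v`; if it is close to `-1`, the term with `θ = 1` is a gain; otherwise `v`, and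
thereby the energy, is bounded below. -/
lemma near_constraint_bound {S A B D T M E V v hb ε δ κ : ℝ} (hδ : 0 < δ) (hM : 0 < M)
    (hε : 0 < ε) (hε1 : ε < 1)
    (hδM : δ * (10000 * (1 + M)) ≤ 1) (hκ : 7000 / ε ≤ κ) (hE : |E| ≤ 1 / 100)
    (hEdef : E = B + 2 * A) (hb0 : 0 ≤ hb) (hV : hb ^ 2 = 1 + E - V) (hV0 : 0 ≤ V) (hVT : V ≤ T)
    (hv : B = v + A ^ 2) (hv0 : 0 ≤ v) (hvT : v ≤ D / 2 + T) (hD : 0 ≤ D) (hBM : B ≤ M)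
    (h : ∀ θ : ℝ, 0 ≤ θ → θ ≤ 1 → S ≤ 11 / 10 * (V + (hb - 1) ^ 2) +
      (49 / 50 + 13 * δ) * D + 9 * δ * B + 6000 / ε * V - θ * (-(1 + A) / 2 - 1 / 6)) :
    -(1 / δ) * E ^ 2 + δ * B + S ≤ (1 - δ) * D + κ * T := by
  have hE' := abs_le.1 hE
  have hδM' : δ * M ≤ 1 / 10000 := by nlinarith
  have hδ1 : δ ≤ 1 / 10000 := by nlinarith [mul_pos hδ hM]
  have hT : 0 ≤ T := hV0.trans hVT
  have hx := dist_one_sq_le hb0 hV0 hV hE'.2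
  have hεV : 6000 / ε * V ≤ 6000 / ε * T := by gcongr
  have hκT : 6000 / ε * T + 1000 * T ≤ κ * T := by
    have : 6000 / ε + 1000 ≤ κ := by
      have h1 : 1 ≤ 1 / ε := by rw [le_div_iff₀ hε]; linarith
      have h2 : 7000 / ε = 6000 / ε + 1000 * (1 / ε) := by ring
      linarith
    nlinarith
  have hEδ : 4 * E ^ 2 ≤ 1 / δ * E ^ 2 := by
    gcongr
    rw [le_div_iff₀ hδ]; linarith
  have hf : (1 + A) ^ 2 = 1 + E - v := by rw [hEdef, hv]; ring
  have hB0 : 0 ≤ B := by rw [hv]; positivity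
  have hδD : δ * D ≤ 1 / 10000 * D := by gcongr
  have base := h 0 le_rfl zero_le_one
  rcases le_total 0 (1 + A) with hA | hA
  · have h1 := dist_one_sq_le hA hv0 hf hE'.2
    have hB : B ≤ 2 * E ^ 2 + 4 * v := by
      have : (1 + A - 1) ^ 2 = A ^ 2 := by ring
      linarith
    have hδB : δ * B ≤ 1 / 10000 * B := by gcongr
    linarith only [base, hx, hεV, hκT, hEδ, hB, hδB, hδD, hvT, hVT, hT, hD, sq_nonneg E]
  · rcases le_total (D / 2 + T) (1 / 4) with hs | hs
    · have h1 := h 1 zero_le_one le_rfl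
      have hA' : 1 + A ≤ -(17 / 20) := by
        by_contra hlt
        push Not at hlt
        have h2 : 0 ≤ (1 + A + 17 / 20) * (17 / 20 - (1 + A)) :=
          mul_nonneg (by linarith only [hlt]) (by linarith only [hA])
        have h3 : (1 + A + 17 / 20) * (17 / 20 - (1 + A)) = 289 / 400 - (1 + A) ^ 2 := by ring
        linarith only [h2, h3, hf, hs, hvT, hE'.1]
      have hδB : δ * B ≤ 1 / 10000 := le_trans (by gcongr) hδM'
      linarith only [h1, hA', hx, hεV, hκT, hEδ, hδB, hδD, hVT, hT, hD, sq_nonneg E]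
    · have hδB : δ * B ≤ 1 / 10000 := le_trans (by gcongr) hδM'
      linarith only [base, hs, hx, hεV, hκT, hEδ, hδB, hδD, hVT, hT, hD, sq_nonneg E]

/-- The conclusion when `|E|` is not small: then `E² / δ` exceeds the constants `C` and `M`. -/
lemma far_constraint_bound {S B D T M E C ε δ κ V : ℝ} (hδ : 0 < δ) (hM : 0 < M) (hε : 0 < ε)
    (hC : 0 ≤ C) (hδM : δ * (10000 * (1 + M + C)) ≤ 1) (hκ : 7000 / ε ≤ κ) (hE : 1 / 100 ≤ |E|)
    (hV0 : 0 ≤ V) (hVT : V ≤ T) (hD : 0 ≤ D) (hBM : B ≤ M)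
    (h : S ≤ C + D / 4 + 8 / ε * V) :
    -(1 / δ) * E ^ 2 + δ * B + S ≤ (1 - δ) * D + κ * T := by
  have hδ1 : δ ≤ 1 / 10000 := by nlinarith [mul_pos hδ hM, mul_nonneg hδ.le hC]
  have hT : 0 ≤ T := hV0.trans hVT
  have hE2 : 1 / 10000 ≤ E ^ 2 := by
    rw [← sq_abs]
    nlinarith
  have h1 : M + C ≤ 1 / δ * E ^ 2 := by
    have h2 : M + C ≤ 1 / δ * (1 / 10000) := by
      rw [div_mul_eq_mul_div, le_div_iff₀ hδ]
      nlinarith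
    exact h2.trans (by gcongr)
  have hεV : 8 / ε * V ≤ κ * T := by
    have : 8 / ε ≤ κ := le_trans (by gcongr; norm_num) hκ
    exact mul_le_mul this hVT hV0 (le_trans (by positivity) this)
  have hδB : δ * B ≤ M := by nlinarith
  have hδD : δ * D ≤ 1 / 10000 * D := by gcongr
  linarith

section Integration

variable {X : Type*} [MeasurableSpace X] {ν : Measure X} [IsProbabilityMeasure ν]

lemma integrable_sqrt {f : X → ℝ} (hf : Integrable f ν) : Integrable (fun x => √(f x)) ν := by
  refine Integrable.mono' ((integrable_const (1 : ℝ)).add hf.abs)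
    (Real.continuous_sqrt.comp_aestronglyMeasurable hf.aestronglyMeasurable)
    (Filter.Eventually.of_forall fun x => ?_)
  rw [Real.norm_of_nonneg (Real.sqrt_nonneg _), Pi.add_apply]
  have h1 : √(f x) ≤ √|f x| := Real.sqrt_le_sqrt (le_abs_self _)
  have h2 := Real.sq_sqrt (abs_nonneg (f x))
  nlinarith [sq_nonneg (√|f x| - 1)]

lemma integral_sq_sub_const {φ : X → ℝ} (h1 : Integrable φ ν) (h2 : Integrable (fun x => φ x ^ 2) ν)
    (r : ℝ) : Integrable (fun x => (φ x - r) ^ 2) ν ∧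
      ∫ x, (φ x - r) ^ 2 ∂ν = (∫ x, φ x ^ 2 ∂ν) - (∫ x, φ x ∂ν) ^ 2 + ((∫ x, φ x ∂ν) - r) ^ 2 := by
  have e : ∀ x, (φ x - r) ^ 2 = φ x ^ 2 - 2 * r * φ x + r ^ 2 := fun x => by ring
  have j1 := integral_add (h2.sub (h1.const_mul (2 * r))) (integrable_const (r ^ 2))
  have j2 := integral_sub h2 (h1.const_mul (2 * r))
  simp only [Pi.sub_apply] at j1
  simp only [e]
  refine ⟨(h2.sub (h1.const_mul (2 * r))).add (integrable_const _), ?_⟩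
  rw [j1, j2, integral_const_mul]
  simp
  ring

/-- The functional inequality in terms of the slice moments: `T` bounds the variances of
the slice means and of the slice norms of `W` and `1 + W`. -/
lemma integrated_bound {a b c e D : X → ℝ} {ε δ κ M T : ℝ} (hδ : 0 < δ) (hM : 0 < M) (hε : 0 < ε)
    (hε1 : ε < 1)
    (hδM : δ * (10000 * (1 + M + (4 * M + 4 * (1 + 16 * M ^ 2) +
      4096 * ((∫ z in Ioo 0 1, logWeight z ^ 3) * (4 * M) ^ 3)))) ≤ 1)
    (hκ : 7000 / ε ≤ κ) (ha : Integrable a ν) (hb : Integrable b ν) (hc : Integrable c ν)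
    (he : Integrable e ν) (hD : Integrable D ν)
    (H : ∀ᵐ x ∂ν, IsSliceMoments ε (a x) (b x) (c x) (e x) (D x))
    (hbM : ∫ x, b x ∂ν ≤ M)
    (hVa : (∫ x, a x ^ 2 ∂ν) - (∫ x, a x ∂ν) ^ 2 ≤ T)
    (hVk : (∫ x, b x ∂ν) - (∫ x, √(b x) ∂ν) ^ 2 ≤ T)
    (hVh : (∫ x, (1 + 2 * a x + b x) ∂ν) - (∫ x, √(1 + 2 * a x + b x) ∂ν) ^ 2 ≤ T) :
    -(1 / δ) * ((∫ x, b x ∂ν) + 2 * ∫ x, a x ∂ν) ^ 2 + (1 + δ) * (∫ x, b x ∂ν) +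
      2 / 3 * (∫ x, c x ∂ν) + δ * (∫ x, e x ∂ν) ≤ (1 - δ) * (∫ x, D x ∂ν) + κ * T := by
  set L := ∫ z in Ioo 0 1, logWeight z ^ 3 with hL
  have hL0 : 0 ≤ L := setIntegral_nonneg measurableSet_Ioo fun z hz =>
    pow_nonneg (logWeight_nonneg hz.1 hz.2) 3
  set C := 4 * M + 4 * (1 + 16 * M ^ 2) + 4096 * (L * (4 * M) ^ 3) with hC
  have hC0 : 0 ≤ C := by positivity
  have hδ1 : δ ≤ 1 / 3 := by nlinarith [mul_pos hδ hM, mul_nonneg hδ.le hC0]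
  have ha2 : Integrable (fun x => a x ^ 2) ν := by
    refine Integrable.mono' hb (ha.aestronglyMeasurable.pow 2) ?_
    filter_upwards [H] with x hx
    rw [Real.norm_of_nonneg (sq_nonneg _)]
    exact hx.sq_le
  have hq : Integrable (fun x => 1 + 2 * a x + b x) ν :=
    ((integrable_const _).add (ha.const_mul 2)).add hb
  have hqv : ∫ x, (1 + 2 * a x + b x) ∂ν = 1 + 2 * (∫ x, a x ∂ν) + ∫ x, b x ∂ν := by
    have j1 := integral_add ((integrable_const (1 : ℝ)).add (ha.const_mul 2)) hb
    have j2 := integral_add (integrable_const (μ := ν) (1 : ℝ)) (ha.const_mul 2)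
    simp only [Pi.add_apply] at j1
    rw [j1, j2, integral_const_mul]
    simp
  have hhi := integrable_sqrt hq
  have hki := integrable_sqrt hb
  have hh2 : (fun x => √(1 + 2 * a x + b x) ^ 2) =ᵐ[ν] fun x => 1 + 2 * a x + b x := by
    filter_upwards [H] with x hx using Real.sq_sqrt hx.norm_sq_nonneg
  have hk2 : (fun x => √(b x) ^ 2) =ᵐ[ν] b := by
    filter_upwards [H] with x hx using Real.sq_sqrt ((sq_nonneg _).trans hx.sq_le)
  have vh := integral_sq_sub_const hhi (hq.congr hh2.symm)
  have vk := integral_sq_sub_const hki (hb.congr hk2.symm)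
  have va := integral_sq_sub_const ha ha2
  rw [integral_congr_ae hh2] at vh
  rw [integral_congr_ae hk2] at vk
  set hbar := ∫ x, √(1 + 2 * a x + b x) ∂ν with hhbar
  set kbar := ∫ x, √(b x) ∂ν with hkbar
  set A := ∫ x, a x ∂ν with hA
  set B := ∫ x, b x ∂ν with hB
  have hD0 : 0 ≤ ∫ x, D x ∂ν := integral_nonneg_of_ae (by
    filter_upwards [H] with x hx using hx.energy_nonneg)
  have hh0 : 0 ≤ hbar := integral_nonneg fun x => Real.sqrt_nonneg _
  have pv : ∀ {φ : X → ℝ} {r Q : ℝ}, ∫ x, (φ x - r) ^ 2 ∂ν = Q → 0 ≤ Q := fun h =>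
    h ▸ integral_nonneg fun x => sq_nonneg _
  have vh0 := pv (vh hbar).2
  have vk0 := pv (vk kbar).2
  have va0 := pv (va A).2
  rw [sub_self, zero_pow two_ne_zero, add_zero] at vh0 vk0 va0
  set S := B + 2 / 3 * (∫ x, c x ∂ν) + δ * ∫ x, e x ∂ν with hS
  have iS : Integrable (fun x => b x + 2 / 3 * c x + δ * e x) ν :=
    (hb.add (hc.const_mul _)).add (he.const_mul _)
  have eS : ∫ x, (b x + 2 / 3 * c x + δ * e x) ∂ν = S := by
    have j1 := integral_add (hb.add (hc.const_mul (2 / 3))) (he.const_mul δ)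
    have j2 := integral_add hb (hc.const_mul (2 / 3))
    simp only [Pi.add_apply] at j1
    rw [j1, j2, integral_const_mul, integral_const_mul]
  have main : -(1 / δ) * (B + 2 * A) ^ 2 + δ * B + S ≤ (1 - δ) * (∫ x, D x ∂ν) + κ * T := by
    rcases le_total |B + 2 * A| (1 / 100) with hE | hE
    · have hE2 := (abs_le.1 hE).2
      have hM1 : δ * (10000 * (1 + M)) ≤ 1 :=
        (mul_le_mul_of_nonneg_left (by linarith only [hC0]) hδ.le).trans hδM
      have hh1 : hbar ≤ 201 / 200 := by nlinarith
      refine near_constraint_bound (V := 1 + 2 * A + B - hbar ^ 2) (v := B - A ^ 2) (A := A)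
        (hb := hbar) hδ hM hε hε1 hM1 hκ hE rfl hh0 (by ring) (by rw [← hqv]; exact vh0)
        (by rw [← hqv]; exact hVh) (by ring) ?_ ?_ hD0 hbM fun θ hθ hθ1 => ?_
      · have : ∫ x, a x ^ 2 ∂ν ≤ B := by
          refine integral_mono_ae ha2 hb ?_
          filter_upwards [H] with x hx using hx.sq_le
        linarith
      · have h1 : ∫ x, 2 * (b x - a x ^ 2) ∂ν ≤ ∫ x, D x ∂ν := by
          refine integral_mono_ae ((hb.sub ha2).const_mul 2) hD ?_
          filter_upwards [H] with x hx using hx.poincare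
        rw [integral_const_mul, integral_sub hb ha2] at h1
        linarith
      · have i1 := (vh 1).1.const_mul (11 / 10)
        have i2 := hD.const_mul (49 / 50 + 13 * δ)
        have i3 := hb.const_mul (9 * δ)
        have i4 := (vh hbar).1.const_mul (6000 / ε)
        have i5 : Integrable (fun x => θ * (-(1 + a x) / 2 - 1 / 6)) ν :=
          (((((integrable_const _).add ha).neg).div_const 2).sub (integrable_const _)).const_mul θ
        have e5 : ∫ x, θ * (-(1 + a x) / 2 - 1 / 6) ∂ν = θ * (-(1 + A) / 2 - 1 / 6) := by
          have : ∀ x, θ * (-(1 + a x) / 2 - 1 / 6) = θ * (-(2 / 3)) + -(θ / 2) * a x := fun x => by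
            ring
          simp only [this]
          have j := integral_add (integrable_const (μ := ν) (θ * (-(2 / 3)))) (ha.const_mul (-(θ / 2)))
          rw [j, integral_const, integral_const_mul, probReal_univ, one_smul]
          ring
        have hmono : ∫ x, (b x + 2 / 3 * c x + δ * e x) ∂ν ≤ ∫ x, (11 / 10 *
            (√(1 + 2 * a x + b x) - 1) ^ 2 + (49 / 50 + 13 * δ) * D x + 9 * δ * b x +
              6000 / ε * (√(1 + 2 * a x + b x) - hbar) ^ 2 -
                θ * (-(1 + a x) / 2 - 1 / 6)) ∂ν := by
          refine integral_mono_ae iS ((((i1.add i2).add i3).add i4).sub i5) ?_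
          filter_upwards [H] with x hx
          exact hx.le_of_near_constraint hε hε1 hδ hδ1 hh1 hθ hθ1
        have j1 := integral_sub (((i1.add i2).add i3).add i4) i5
        have j2 := integral_add ((i1.add i2).add i3) i4
        have j3 := integral_add (i1.add i2) i3
        have j4 := integral_add i1 i2
        simp only [Pi.add_apply] at j1 j2 j3 j4
        rw [j1, j2, j3, j4, eS, e5, integral_const_mul, integral_const_mul, integral_const_mul,
          integral_const_mul, (vh 1).2, (vh hbar).2, hqv] at hmono
        linarith
    · refine far_constraint_bound (V := B - kbar ^ 2) hδ hM hε hC0 hδM hκ hE vk0 hVk hD0 hbM ?_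
      have i2 := hD.div_const 4
      have i4 := (vk kbar).1.const_mul (8 / ε)
      have hmono : ∫ x, (b x + 2 / 3 * c x + δ * e x) ∂ν ≤
          ∫ x, (C + D x / 4 + 8 / ε * (√(b x) - kbar) ^ 2) ∂ν := by
        refine integral_mono_ae iS (((integrable_const C).add i2).add i4) ?_
        filter_upwards [H] with x hx
        exact hx.le_of_far hε hε1 hδ1 hM (by linarith) hL0
      have j1 := integral_add ((integrable_const C).add i2) i4
      have j2 := integral_add (integrable_const (μ := ν) C) i2
      simp only [Pi.add_apply] at j1
      rw [j1, j2, eS, integral_const_mul, (vk kbar).2, integral_div] at hmono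
      simpa using hmono
  rw [hS] at main
  linarith

end Integration

/-! ### Oscillation between slices -/

/-- A function on the torus all of whose translates are close to it in `L²` is close to its mean. -/
lemma variance_le_of_translates {φ : UnitAddCircle × UnitAddCircle → ℝ} (hφ : Measurable φ)
    {B : ℝ} (hB : ∀ x, |φ x| ≤ B) {T : ℝ}
    (h : ∀ t, ∫ x, (φ (x + t) - φ x) ^ 2 ≤ 2 * T) :
    (∫ x, φ x ^ 2) - (∫ x, φ x) ^ 2 ≤ T := by
  have hB0 : 0 ≤ B := (abs_nonneg _).trans (hB 0)
  have i1 : Integrable φ := Integrable.of_bound hφ.aestronglyMeasurable B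
    (Filter.Eventually.of_forall hB)
  have i2 : Integrable fun x => φ x ^ 2 :=
    Integrable.of_bound (hφ.pow_const 2).aestronglyMeasurable (B ^ 2)
      (Filter.Eventually.of_forall fun x => by
        rw [norm_pow]; exact pow_le_pow_left₀ (norm_nonneg _) (hB x) 2)
  have hm : Measurable fun q : (UnitAddCircle × UnitAddCircle) × (UnitAddCircle × UnitAddCircle) =>
      φ (q.2 + q.1) * φ q.2 := by fun_prop
  have hb : ∀ s t, ‖φ s * φ t‖ ≤ B * B := fun s t => by
    rw [norm_mul]; exact mul_le_mul (hB s) (hB t) (norm_nonneg _) hB0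
  have i3 : Integrable (fun q : (UnitAddCircle × UnitAddCircle) × (UnitAddCircle × UnitAddCircle) =>
      φ (q.2 + q.1) * φ q.2) (volume.prod volume) :=
    Integrable.of_bound hm.aestronglyMeasurable (B * B) (Filter.Eventually.of_forall fun q => hb _ _)
  have e1 : ∫ t, ∫ x, φ (x + t) * φ x = (∫ x, φ x) ^ 2 := by
    rw [integral_integral_swap i3]
    have : ∀ x, ∫ t, φ (x + t) * φ x = (∫ t, φ t) * φ x := fun x => by
      rw [integral_mul_const, integral_add_left_eq_self]
    simp only [this]
    rw [integral_const_mul, sq]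
  have e2 : ∀ t, (∫ x, φ x ^ 2) - ∫ x, φ (x + t) * φ x ≤ T := by
    intro t
    have i4 : Integrable fun x => φ (x + t) * φ x :=
      Integrable.of_bound (by fun_prop) (B * B) (Filter.Eventually.of_forall fun q => hb _ _)
    have i5 : Integrable fun x => φ (x + t) ^ 2 := i2.comp_add_right t
    have e : ∀ x, (φ (x + t) - φ x) ^ 2 = φ (x + t) ^ 2 + φ x ^ 2 - 2 * (φ (x + t) * φ x) :=
      fun x => by ring
    have j1 := integral_sub (i5.add i2) (i4.const_mul 2)
    have j2 := integral_add i5 i2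
    simp only [Pi.add_apply] at j1
    have h1 := h t
    simp only [e] at h1
    rw [j1, j2, integral_const_mul, integral_add_right_eq_self (fun x => φ x ^ 2)] at h1
    linarith
  have i6 : Integrable fun t => ∫ x, φ (x + t) * φ x := i3.integral_prod_left
  have h3 : ∫ t : UnitAddCircle × UnitAddCircle, ((∫ x, φ x ^ 2) - ∫ x, φ (x + t) * φ x) ≤
      ∫ _ : UnitAddCircle × UnitAddCircle, T :=
    integral_mono ((integrable_const _).sub i6) (integrable_const _) e2
  rw [integral_sub (integrable_const _) i6, e1] at h3
  simpa using h3

/-- The reverse triangle inequality in `L²`. -/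
lemma sq_sqrt_sub_sqrt_le {α : Type*} [MeasurableSpace α] {μ : Measure α} {u v : α → ℝ}
    (hu : AEMeasurable u μ) (hv : AEMeasurable v μ) (hu2 : Integrable (fun x => u x ^ 2) μ)
    (hv2 : Integrable (fun x => v x ^ 2) μ) (huv : Integrable (fun x => u x * v x) μ) :
    (√(∫ x, u x ^ 2 ∂μ) - √(∫ x, v x ^ 2 ∂μ)) ^ 2 ≤ ∫ x, (u x - v x) ^ 2 ∂μ := by
  have hU : 0 ≤ ∫ x, u x ^ 2 ∂μ := integral_nonneg fun x => sq_nonneg _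
  have hV : 0 ≤ ∫ x, v x ^ 2 ∂μ := integral_nonneg fun x => sq_nonneg _
  have h1 := sq_integral_mul_le hu hv hu2 hv2
  have h2 : ∫ x, u x * v x ∂μ ≤ √(∫ x, u x ^ 2 ∂μ) * √(∫ x, v x ^ 2 ∂μ) := by
    refine abs_le_of_sq_le_sq' ?_ (by positivity) |>.2
    rwa [mul_pow, Real.sq_sqrt hU, Real.sq_sqrt hV]
  have e : ∀ x, (u x - v x) ^ 2 = u x ^ 2 + v x ^ 2 - 2 * (u x * v x) := fun x => by ring
  have j1 := integral_sub (hu2.add hv2) (huv.const_mul 2)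
  have j2 := integral_add hu2 hv2
  simp only [Pi.add_apply] at j1
  simp only [e]
  rw [j1, j2, integral_const_mul]
  nlinarith [Real.sq_sqrt hU, Real.sq_sqrt hV]

lemma IsWeightedPrimitive.isSliceMoments {w γ : ℝ → ℝ} (h : IsWeightedPrimitive w γ) {ε : ℝ}
    (hε : 0 < ε) (hb : ∀ z, |w z| ≤ 1 / ε) :
    IsSliceMoments ε (∫ z in Ioo 0 1, w z) (∫ z in Ioo 0 1, w z ^ 2) (∫ z in Ioo 0 1, w z ^ 3)
      (∫ z in Ioo 0 1, |w z| ^ 3) (∫ z in Ioo 0 1, z * (1 - z) * γ z ^ 2) := by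
  set m := ∫ z in Ioo 0 1, w z with hm
  obtain ⟨h1, h2, h3, h4, h5⟩ := h.moment_bounds hm rfl rfl
  have i2 := h.integrable_comp (F := fun x => x ^ 2) (by fun_prop)
  have i3 := h.integrable_comp (F := fun x => x ^ 3) (by fun_prop)
  have i3' := h.integrable_comp (F := fun x => |x| ^ 3) (by fun_prop)
  have iu := h.integrable_comp (F := fun x => |x - m| ^ 3) (by fun_prop)
  refine ⟨by linarith, h2, ⟨_, integral_nonneg fun z => by positivity, h3, h4, by nlinarith, ?_⟩,
    ?_, integral_nonneg fun z => by positivity, ?_⟩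
  · have j : ∫ z in Ioo (0 : ℝ) 1, |w z| ^ 3 ≤ ∫ z in Ioo (0 : ℝ) 1, 4 * (|m| ^ 3 + |w z - m| ^ 3) := by
      refine integral_mono i3' (((integrable_const _).add iu).const_mul 4) fun z => ?_
      have h6 : |w z| ≤ |m| + |w z - m| := by
        have := abs_add_le m (w z - m)
        rwa [add_sub_cancel] at this
      have p := abs_nonneg m
      have q := abs_nonneg (w z - m)
      have h7 := pow_le_pow_left₀ (abs_nonneg (w z)) h6 3
      have h8 : 4 * (|m| ^ 3 + |w z - m| ^ 3) - (|m| + |w z - m|) ^ 3 =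
        3 * (|m| + |w z - m|) * (|m| - |w z - m|) ^ 2 := by ring
      have h9 : 0 ≤ 3 * (|m| + |w z - m|) * (|m| - |w z - m|) ^ 2 := by positivity
      simp only
      linarith
    rw [integral_const_mul, integral_add (integrable_const _) iu, integral_const, probReal_univ,
      one_smul] at j
    exact j
  · refine integral_mono i3 i3' fun z => ?_
    simp only
    rw [← abs_pow]; exact le_abs_self _
  · rw [← integral_const_mul]
    refine integral_mono (i3'.const_mul ε) i2 fun z => ?_
    have h6 : ε * |w z| ≤ 1 := by
      have := mul_le_mul_of_nonneg_left (hb z) hε.le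
      rwa [mul_one_div_cancel hε.ne'] at this
    have h7 : ε * |w z| ^ 3 = ε * |w z| * w z ^ 2 := by rw [← sq_abs (w z)]; ring
    simp only
    rw [h7]
    exact mul_le_of_le_one_left (sq_nonneg _) h6

/-! ### The inequality on the cylinder -/

lemma volume_restrict_Omega :
    (volume : Measure Cyl).restrict Omega = (volume.restrict (Ioo (0 : ℝ) 1)).prod volume :=
  volume_restrict_strip _

instance : IsProbabilityMeasure ((volume : Measure Cyl).restrict Omega) := by
  rw [volume_restrict_Omega]; infer_instance

lemma ofReal_weight_mul_sq_integrable {g : Cyl → ℝ}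
    (hg : AEStronglyMeasurable g (volume.restrict Omega))
    (hfin : ∫⁻ p in Omega, ENNReal.ofReal (p.1 * (1 - p.1) * g p ^ 2) ≠ ⊤) :
    IntegrableOn (fun p => p.1 * (1 - p.1) * g p ^ 2) Omega ∧
      ∫ p in Omega, p.1 * (1 - p.1) * g p ^ 2 =
        (∫⁻ p in Omega, ENNReal.ofReal (p.1 * (1 - p.1) * g p ^ 2)).toReal := by
  have h0 : 0 ≤ᵐ[volume.restrict Omega] fun p : Cyl => p.1 * (1 - p.1) * g p ^ 2 := by
    filter_upwards [ae_restrict_mem isOpen_Omega.measurableSet] with p hp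
    exact mul_nonneg (mul_nonneg hp.1.1.le (sub_nonneg.2 hp.1.2.le)) (sq_nonneg _)
  have hm : AEStronglyMeasurable (fun p : Cyl => p.1 * (1 - p.1) * g p ^ 2)
      (volume.restrict Omega) :=
    (Continuous.aestronglyMeasurable (by fun_prop)).mul (hg.pow 2)
  refine ⟨⟨hm, ?_⟩, integral_eq_lintegral_of_nonneg_ae h0 hm⟩
  rw [hasFiniteIntegral_iff_ofReal h0]
  exact lt_top_iff_ne_top.2 hfin

/-- The inequality for a bounded measurable `W` and measurable weak derivatives. -/
lemma inequality_of_measurable {M ε δ κ : ℝ} (hδ : 0 < δ) (hM : 0 < M) (hε : 0 < ε) (hε1 : ε < 1)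
    (hδM : δ * (10000 * (1 + M + (4 * M + 4 * (1 + 16 * M ^ 2) +
      4096 * ((∫ z in Ioo 0 1, logWeight z ^ 3) * (4 * M) ^ 3)))) ≤ 1)
    (hκ : 7000 / ε ≤ κ) {W g₀ g₁ g₂ : Cyl → ℝ} (hW : Measurable W) (hg₀ : Measurable g₀)
    (hg₁ : Measurable g₁) (hg₂ : Measurable g₂) (hb : ∀ p, |W p| ≤ 1 / ε)
    (h₀ : IsWeakDeriv 0 W g₀) (h₁ : IsWeakDeriv 1 W g₁) (h₂ : IsWeakDeriv 2 W g₂)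
    (hWM : ∫ p in Omega, W p ^ 2 ≤ M)
    (hf₀ : ∫⁻ p in Omega, ENNReal.ofReal (p.1 * (1 - p.1) * g₀ p ^ 2) ≠ ⊤)
    (hf : (∫⁻ p in Omega, ENNReal.ofReal (g₁ p ^ 2)) +
      ∫⁻ p in Omega, ENNReal.ofReal (g₂ p ^ 2) ≠ ⊤) :
    -(1 / δ) * ((∫ p in Omega, W p ^ 2) + 2 * ∫ p in Omega, W p) ^ 2
      + (1 + δ) * (∫ p in Omega, W p ^ 2) + 2 / 3 * (∫ p in Omega, W p ^ 3)
      + δ * (∫ p in Omega, |W p| ^ 3) ≤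
      (1 - δ) * (∫⁻ p in Omega, ENNReal.ofReal (p.1 * (1 - p.1) * g₀ p ^ 2)).toReal +
      κ * ((∫⁻ p in Omega, ENNReal.ofReal (g₁ p ^ 2)) +
        ∫⁻ p in Omega, ENNReal.ofReal (g₂ p ^ 2)).toReal := by
  set μ := volume.restrict (Ioo (0 : ℝ) 1) with hμ
  set T := ((∫⁻ p in Omega, ENNReal.ofReal (g₁ p ^ 2)) +
        ∫⁻ p in Omega, ENNReal.ofReal (g₂ p ^ 2)).toReal with hT
  have hcomp : ∀ F : ℝ → ℝ, Continuous F →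
      Integrable (fun p => F (W p)) (volume.restrict Omega) := by
    intro F hF
    obtain ⟨C, hC⟩ := (isCompact_Icc (a := -(1 / ε)) (b := 1 / ε)).exists_bound_of_continuousOn
      hF.continuousOn
    exact Integrable.of_bound (hF.measurable.comp hW).aestronglyMeasurable C
      (Filter.Eventually.of_forall fun z => hC _ (abs_le.1 (hb z)))
  have hslice : ∀ F : ℝ → ℝ, Continuous F → ∀ x, Integrable (fun z => F (W (z, x))) μ := by
    intro F hF x
    obtain ⟨C, hC⟩ := (isCompact_Icc (a := -(1 / ε)) (b := 1 / ε)).exists_bound_of_continuousOn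
      hF.continuousOn
    exact Integrable.of_bound (hF.measurable.comp (hW.comp measurable_prodMk_right)).aestronglyMeasurable
      C (Filter.Eventually.of_forall fun z => hC _ (abs_le.1 (hb _)))
  have hfub : ∀ G : Cyl → ℝ, IntegrableOn G Omega →
      Integrable (fun x => ∫ z, G (z, x) ∂μ) ∧ ∫ p in Omega, G p = ∫ x, ∫ z, G (z, x) ∂μ := by
    intro G hG
    rw [IntegrableOn, volume_restrict_Omega] at hG
    rw [volume_restrict_Omega]
    exact ⟨hG.integral_prod_right, integral_prod_symm _ hG⟩
  obtain ⟨hDi, hDv⟩ := ofReal_weight_mul_sq_integrable hg₀.aestronglyMeasurable hf₀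
  have f1 := hfub _ (hcomp (fun x => x) continuous_id)
  have f2 := hfub _ (hcomp (fun x => x ^ 2) (by fun_prop))
  have f3 := hfub _ (hcomp (fun x => x ^ 3) (by fun_prop))
  have f4 := hfub _ (hcomp (fun x => |x| ^ 3) (by fun_prop))
  have f5 := hfub _ hDi
  simp only at f1 f2 f3 f4 f5
  have hprim : ∀ᵐ x : UnitAddCircle × UnitAddCircle,
      IsWeightedPrimitive (fun z => W (z, x)) (fun z => g₀ (z, x)) := by
    have hDi' := hDi
    rw [IntegrableOn, volume_restrict_Omega] at hDi'
    filter_upwards [h₀.ae_line hW hg₀, hDi'.prod_left_ae] with x hx hx'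
    exact ⟨hW.comp measurable_prodMk_right, hg₀.comp measurable_prodMk_right,
      ⟨1 / ε, fun z => hb _⟩, hx', hx⟩
  have hmom : ∀ᵐ x : UnitAddCircle × UnitAddCircle, IsSliceMoments ε (∫ z, W (z, x) ∂μ)
      (∫ z, W (z, x) ^ 2 ∂μ) (∫ z, W (z, x) ^ 3 ∂μ) (∫ z, |W (z, x)| ^ 3 ∂μ)
      (∫ z, z * (1 - z) * g₀ (z, x) ^ 2 ∂μ) := by
    filter_upwards [hprim] with x hx using hx.isSliceMoments hε fun z => hb _
  -- translates of `W`
  have htrans : ∀ t : UnitAddCircle × UnitAddCircle,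
      Integrable (fun x => ∫ z, (W (z, x + t) - W (z, x)) ^ 2 ∂μ) ∧
      ∫ x, ∫ z, (W (z, x + t) - W (z, x)) ^ 2 ∂μ ≤ 2 * T := by
    intro t
    have hm : Measurable fun p : Cyl => (W (p.1, p.2 + t) - W p) ^ 2 := by fun_prop
    have hi : IntegrableOn (fun p : Cyl => (W (p.1, p.2 + t) - W p) ^ 2) Omega := by
      refine Integrable.of_bound hm.aestronglyMeasurable ((1 / ε + 1 / ε) ^ 2)
        (Filter.Eventually.of_forall fun p => ?_)
      rw [norm_pow]
      exact pow_le_pow_left₀ (norm_nonneg _)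
        ((norm_sub_le _ _).trans (add_le_add (hb _) (hb _))) 2
    have h3 := hfub _ hi
    refine ⟨h3.1, ?_⟩
    rw [← h3.2, integral_eq_lintegral_of_nonneg_ae
      (Filter.Eventually.of_forall fun p => sq_nonneg _) hm.aestronglyMeasurable]
    have h4 := lintegral_sq_sub_translate_le h₁ h₂ hW hg₁ hg₂ (hcomp (fun x => x) continuous_id) t
    have h5 := ENNReal.toReal_mono (ENNReal.mul_ne_top (by norm_num) hf) h4
    rwa [ENNReal.toReal_mul, ENNReal.toReal_ofNat, ← hT] at h5
  have hvar : ∀ (φ : UnitAddCircle × UnitAddCircle → ℝ) (B : ℝ), Measurable φ →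
      (∀ x, |φ x| ≤ B) →
      (∀ x t, (φ (x + t) - φ x) ^ 2 ≤ ∫ z, (W (z, x + t) - W (z, x)) ^ 2 ∂μ) →
      (∫ x, φ x ^ 2) - (∫ x, φ x) ^ 2 ≤ T := by
    intro φ B hφ hB hφW
    refine variance_le_of_translates hφ hB fun t => ?_
    exact (integral_mono_of_nonneg (Filter.Eventually.of_forall fun x => sq_nonneg _) (htrans t).1
      (Filter.Eventually.of_forall fun x => hφW x t)).trans (htrans t).2
  have hmeas : ∀ F : ℝ → ℝ, Continuous F → Measurable fun x => ∫ z, F (W (z, x)) ∂μ := by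
    intro F hF
    exact (StronglyMeasurable.integral_prod_right (f := fun x z => F (W (z, x)))
      (Measurable.stronglyMeasurable (hF.measurable.comp
        (hW.comp measurable_swap)))).measurable
  have hnorm : ∀ r : ℝ, (∀ x, |√(∫ z, (r + W (z, x)) ^ 2 ∂μ)| ≤ |r| + 1 / ε) ∧
      ∀ x t, (√(∫ z, (r + W (z, x + t)) ^ 2 ∂μ) - √(∫ z, (r + W (z, x)) ^ 2 ∂μ)) ^ 2 ≤
        ∫ z, (W (z, x + t) - W (z, x)) ^ 2 ∂μ := by
    intro r
    have hrb : ∀ p, |r + W p| ≤ |r| + 1 / ε := fun p =>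
      (abs_add_le _ _).trans (add_le_add_right (hb p) _)
    refine ⟨fun x => ?_, fun x t => ?_⟩
    · rw [abs_of_nonneg (Real.sqrt_nonneg _)]
      refine Real.sqrt_le_iff.2 ⟨by positivity, ?_⟩
      have : ∫ z, (r + W (z, x)) ^ 2 ∂μ ≤ ∫ _, (|r| + 1 / ε) ^ 2 ∂μ := by
        refine integral_mono (hslice (fun y => (r + y) ^ 2) (by fun_prop) x) (integrable_const _)
          fun z => ?_
        simp only
        rw [← sq_abs]
        exact pow_le_pow_left₀ (abs_nonneg _) (hrb _) 2
      simpa using this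
    · have hmr : ∀ x, Measurable fun z => r + W (z, x) := fun x =>
        (hW.comp measurable_prodMk_right).const_add r
      have := sq_sqrt_sub_sqrt_le (μ := μ) (u := fun z => r + W (z, x + t))
        (v := fun z => r + W (z, x)) (hmr _).aemeasurable (hmr _).aemeasurable
        (hslice (fun y => (r + y) ^ 2) (by fun_prop) _)
        (hslice (fun y => (r + y) ^ 2) (by fun_prop) _)
        (Integrable.of_bound ((hmr _).mul (hmr _)).aestronglyMeasurable
          ((|r| + 1 / ε) * (|r| + 1 / ε)) (Filter.Eventually.of_forall fun z => by
            rw [norm_mul]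
            exact mul_le_mul (hrb _) (hrb _) (norm_nonneg _) (by positivity)))
      simpa only [add_sub_add_left_eq_sub] using this
  have hq : ∀ x, ∫ z, (1 + W (z, x)) ^ 2 ∂μ =
      1 + 2 * (∫ z, W (z, x) ∂μ) + ∫ z, W (z, x) ^ 2 ∂μ := by
    intro x
    have e : ∀ z, (1 + W (z, x)) ^ 2 = 1 + 2 * W (z, x) + W (z, x) ^ 2 := fun z => by ring
    have k1 := hslice (fun y => y) continuous_id x
    have j1 := integral_add ((integrable_const (1 : ℝ)).add (k1.const_mul 2))
      (hslice (fun y => y ^ 2) (by fun_prop) x)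
    have j2 := integral_add (integrable_const (μ := μ) (1 : ℝ)) (k1.const_mul 2)
    simp only [Pi.add_apply] at j1
    simp only [e]
    rw [j1, j2, integral_const_mul]
    simp
  -- the slice means and the slice norms of `W` and `1 + W` vary less than `W` does
  have Va := hvar (fun x => ∫ z, W (z, x) ∂μ) (1 / ε) (hmeas (fun y => y) continuous_id) (by
      intro x
      have := norm_integral_le_of_norm_le_const (μ := μ) (f := fun z => W (z, x))
        (C := 1 / ε) (Filter.Eventually.of_forall fun z => hb (z, x))
      simpa using this) (by
      intro x t
      have k1 := hslice (fun y => y) continuous_id x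
      have k2 := hslice (fun y => y) continuous_id (x + t)
      have := sq_integral_mul_le (μ := μ) (f := fun _ => 1) (g := fun z => W (z, x + t) - W (z, x))
        aemeasurable_const ((hW.comp measurable_prodMk_right).sub
          (hW.comp measurable_prodMk_right)).aemeasurable (integrable_const _)
        (Integrable.of_bound (((hW.comp measurable_prodMk_right).sub
          (hW.comp measurable_prodMk_right)).pow_const 2).aestronglyMeasurable ((1 / ε + 1 / ε) ^ 2)
          (Filter.Eventually.of_forall fun z => by
            rw [norm_pow]
            exact pow_le_pow_left₀ (norm_nonneg _)
              ((norm_sub_le _ _).trans (add_le_add (hb _) (hb _))) 2))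
      simp only [one_mul] at this
      rw [integral_sub k2 k1] at this
      simpa using this)
  have Vk := hvar (fun x => √(∫ z, W (z, x) ^ 2 ∂μ)) (|0| + 1 / ε)
    (hmeas (fun y => y ^ 2) (by fun_prop)).sqrt
    (by simpa only [zero_add] using (hnorm 0).1) (by simpa only [zero_add] using (hnorm 0).2)
  have Vh := hvar (fun x => √(∫ z, (1 + W (z, x)) ^ 2 ∂μ)) (|1| + 1 / ε)
    (hmeas (fun y => (1 + y) ^ 2) (by fun_prop)).sqrt (hnorm 1).1 (hnorm 1).2
  have s1 : ∀ x, √(∫ z, W (z, x) ^ 2 ∂μ) ^ 2 = ∫ z, W (z, x) ^ 2 ∂μ := fun x =>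
    Real.sq_sqrt (integral_nonneg fun z => sq_nonneg _)
  have s2 : ∀ x, √(∫ z, (1 + W (z, x)) ^ 2 ∂μ) ^ 2 = ∫ z, (1 + W (z, x)) ^ 2 ∂μ := fun x =>
    Real.sq_sqrt (integral_nonneg fun z => sq_nonneg _)
  simp only [s1] at Vk
  simp only [s2] at Vh
  simp only [hq] at Vh
  rw [f2.2] at hWM
  rw [← hDv, f1.2, f2.2, f3.2, f4.2, f5.2]
  exact integrated_bound hδ hM hε hε1 hδM hκ f1.1 f2.1 f3.1 f4.1 f5.1 hmom hWM Va Vk Vh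

/-! ### Reduction to measurable representatives -/

lemma IsWeakDeriv.congr {i : Fin 3} {W W' g g' : Cyl → ℝ} (h : IsWeakDeriv i W g)
    (hW : W =ᵐ[volume.restrict Omega] W') (hg : g =ᵐ[volume.restrict Omega] g') :
    IsWeakDeriv i W' g' where
  locInt := h.locInt.congr hW
  locInt_deriv := h.locInt_deriv.congr hg
  integral_eq φ hφ := by
    have e1 : ∫ p in Omega, W' p * partialD i φ p = ∫ p in Omega, W p * partialD i φ p :=
      integral_congr_ae (hW.symm.mul Filter.EventuallyEq.rfl)
    have e2 : ∫ p in Omega, g' p * φ p = ∫ p in Omega, g p * φ p :=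
      integral_congr_ae (hg.symm.mul Filter.EventuallyEq.rfl)
    rw [e1, e2, h.integral_eq φ hφ]

lemma IsWeakDeriv.aestronglyMeasurable {i : Fin 3} {W g : Cyl → ℝ} (h : IsWeakDeriv i W g) :
    AEStronglyMeasurable g (volume.restrict Omega) :=
  h.locInt_deriv.aestronglyMeasurable

/-- The inequality for an essentially bounded `W`, which is replaced by a measurable representative
cut off at `±1/ε`. -/
lemma inequality_of_isWeakDeriv {M ε δ κ : ℝ} (hδ : 0 < δ) (hM : 0 < M) (hε : 0 < ε) (hε1 : ε < 1)
    (hδM : δ * (10000 * (1 + M + (4 * M + 4 * (1 + 16 * M ^ 2) +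
      4096 * ((∫ z in Ioo 0 1, logWeight z ^ 3) * (4 * M) ^ 3)))) ≤ 1)
    (hκ : 7000 / ε ≤ κ) {W g₀ g₁ g₂ : Cyl → ℝ} (hW : MemLp W 2 (volume.restrict Omega))
    (hb : eLpNorm W ⊤ (volume.restrict Omega) ≤ ENNReal.ofReal (1 / ε))
    (h₀ : IsWeakDeriv 0 W g₀) (h₁ : IsWeakDeriv 1 W g₁) (h₂ : IsWeakDeriv 2 W g₂)
    (hWM : ∫ p in Omega, W p ^ 2 ≤ M)
    (hf₀ : ∫⁻ p in Omega, ENNReal.ofReal (p.1 * (1 - p.1) * g₀ p ^ 2) ≠ ⊤)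
    (hf : (∫⁻ p in Omega, ENNReal.ofReal (g₁ p ^ 2)) +
      ∫⁻ p in Omega, ENNReal.ofReal (g₂ p ^ 2) ≠ ⊤) :
    -(1 / δ) * ((∫ p in Omega, W p ^ 2) + 2 * ∫ p in Omega, W p) ^ 2
      + (1 + δ) * (∫ p in Omega, W p ^ 2) + 2 / 3 * (∫ p in Omega, W p ^ 3)
      + δ * (∫ p in Omega, |W p| ^ 3) ≤
      (1 - δ) * (∫⁻ p in Omega, ENNReal.ofReal (p.1 * (1 - p.1) * g₀ p ^ 2)).toReal +
      κ * ((∫⁻ p in Omega, ENNReal.ofReal (g₁ p ^ 2)) +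
        ∫⁻ p in Omega, ENNReal.ofReal (g₂ p ^ 2)).toReal := by
  have hε' : 0 < 1 / ε := by positivity
  set V : Cyl → ℝ := fun p =>
    max (-(1 / ε)) (min (1 / ε) (hW.aestronglyMeasurable.mk W p)) with hV
  have hVm : Measurable V :=
    measurable_const.max (measurable_const.min hW.aestronglyMeasurable.stronglyMeasurable_mk.measurable)
  have hVb : ∀ p, |V p| ≤ 1 / ε := fun p =>
    abs_le.2 ⟨le_max_left _ _, max_le (by linarith) (min_le_left _ _)⟩
  have hWb : ∀ᵐ p ∂(volume.restrict Omega), |W p| ≤ 1 / ε := by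
    rw [eLpNorm_exponent_top] at hb
    filter_upwards [enorm_ae_le_eLpNormEssSup W (volume.restrict Omega)] with p hp
    have := hp.trans hb
    rwa [← ofReal_norm, ENNReal.ofReal_le_ofReal_iff hε'.le] at this
  have hWV : W =ᵐ[volume.restrict Omega] V := by
    filter_upwards [hWb, hW.aestronglyMeasurable.ae_eq_mk] with p h1 h2
    rw [hV]
    simp only
    rw [← h2, min_eq_right (abs_le.1 h1).2, max_eq_right (abs_le.1 h1).1]
  have e₀ := h₀.aestronglyMeasurable.ae_eq_mk
  have e₁ := h₁.aestronglyMeasurable.ae_eq_mk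
  have e₂ := h₂.aestronglyMeasurable.ae_eq_mk
  have c₀ := lintegral_congr_ae (e₀.mono fun p hp =>
    show ENNReal.ofReal (p.1 * (1 - p.1) * g₀ p ^ 2) =
      ENNReal.ofReal (p.1 * (1 - p.1) * h₀.aestronglyMeasurable.mk g₀ p ^ 2) by rw [hp])
  have c₁ := lintegral_congr_ae (e₁.fun_comp fun x => ENNReal.ofReal (x ^ 2))
  have c₂ := lintegral_congr_ae (e₂.fun_comp fun x => ENNReal.ofReal (x ^ 2))
  have d₁ := integral_congr_ae hWV
  have d₂ := integral_congr_ae (hWV.fun_comp fun x => x ^ 2)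
  have d₃ := integral_congr_ae (hWV.fun_comp fun x => x ^ 3)
  have d₄ := integral_congr_ae (hWV.fun_comp fun x => |x| ^ 3)
  simp only [Function.comp_def] at c₁ c₂ d₂ d₃ d₄
  rw [c₀] at hf₀ ⊢
  rw [c₁, c₂] at hf ⊢
  rw [d₂] at hWM
  rw [d₁, d₂, d₃, d₄]
  exact inequality_of_measurable hδ hM hε hε1 hδM hκ hVm
    h₀.aestronglyMeasurable.stronglyMeasurable_mk.measurable
    h₁.aestronglyMeasurable.stronglyMeasurable_mk.measurable
    h₂.aestronglyMeasurable.stronglyMeasurable_mk.measurable hVb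
    (h₀.congr hWV e₀) (h₁.congr hWV e₁) (h₂.congr hWV e₂) hWM hf₀ hf

/-! ### The energies as infima -/

lemma exists_isWeakDeriv_zEnergy_le {W : Cyl → ℝ} (h : zEnergy W ≠ ⊤) {η : ℝ} (hη : 0 < η) :
    ∃ g, IsWeakDeriv 0 W g ∧
      ∫⁻ p in Omega, ENNReal.ofReal (p.1 * (1 - p.1) * g p ^ 2) ≤ zEnergy W + ENNReal.ofReal η := by
  have h1 : zEnergy W < zEnergy W + ENNReal.ofReal η :=
    ENNReal.lt_add_right h (by simpa using hη)
  nth_rw 1 [zEnergy] at h1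
  obtain ⟨g, hg⟩ := iInf_lt_iff.1 h1
  obtain ⟨hd, hg⟩ := iInf_lt_iff.1 hg
  exact ⟨g, hd, hg.le⟩

lemma exists_isWeakDeriv_energy_le {i : Fin 3} {W : Cyl → ℝ} (h : energy i W ≠ ⊤) {η : ℝ}
    (hη : 0 < η) :
    ∃ g, IsWeakDeriv i W g ∧
      ∫⁻ p in Omega, ENNReal.ofReal (g p ^ 2) ≤ energy i W + ENNReal.ofReal η := by
  have h1 : energy i W < energy i W + ENNReal.ofReal η :=
    ENNReal.lt_add_right h (by simpa using hη)
  nth_rw 1 [energy] at h1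
  obtain ⟨g, hg⟩ := iInf_lt_iff.1 h1
  obtain ⟨hd, hg⟩ := iInf_lt_iff.1 hg
  exact ⟨g, hd, hg.le⟩

lemma zEnergy_ne_top {W g : Cyl → ℝ} (h : IsWeakDeriv 0 W g)
    (hg : MemLp (fun p => √(p.1 * (1 - p.1)) * g p) 2 (volume.restrict Omega)) :
    zEnergy W ≠ ⊤ := by
  refine ne_top_of_le_ne_top ?_ (iInf₂_le g h)
  have e : ∫⁻ p in Omega, ENNReal.ofReal (p.1 * (1 - p.1) * g p ^ 2) =
      ∫⁻ p in Omega, ENNReal.ofReal ((√(p.1 * (1 - p.1)) * g p) ^ 2) := by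
    refine setLIntegral_congr_fun isOpen_Omega.measurableSet fun p hp => ?_
    rw [mul_pow, Real.sq_sqrt (mul_nonneg hp.1.1.le (sub_nonneg.2 hp.1.2.le))]
  rw [e]
  exact hg.integrable_sq.lintegral_lt_top.ne

/-- For small `ε` the transversal coefficient is much larger than `1/ε`. -/
lemma le_one_sub_div_rpow {ε δ : ℝ} (hε : 0 < ε) (hε1 : ε < 1 / 10 ^ 10) (hδ : δ ≤ 1 / 2) :
    7000 / ε ≤ (1 - δ) / ε ^ (3 / 2 : ℝ) := by
  have h1 : ε ^ (3 / 2 : ℝ) = ε * √ε := by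
    rw [Real.sqrt_eq_rpow, ← Real.rpow_one_add' hε.le (by norm_num)]
    norm_num
  have h2 : √ε ≤ 1 / 10 ^ 5 := by
    refine Real.sqrt_le_iff.2 ⟨by norm_num, hε1.le.trans (by norm_num)⟩
  have h3 : 0 < √ε := Real.sqrt_pos.2 hε
  rw [h1, div_le_div_iff₀ hε (by positivity)]
  have := mul_le_mul_of_nonneg_left h2 hε.le
  nlinarith

lemma R_nonpos {M ε δ : ℝ} (hδ : 0 < δ) (hδ1 : δ ≤ 1 / 2) (hM : 0 < M) (hε : 0 < ε)
    (hε1 : ε < 1 / 10 ^ 10)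
    (hδM : δ * (10000 * (1 + M + (4 * M + 4 * (1 + 16 * M ^ 2) +
      4096 * ((∫ z in Ioo 0 1, logWeight z ^ 3) * (4 * M) ^ 3)))) ≤ 1)
    {W : Cyl → ℝ} (hW : MemLp W 2 (volume.restrict Omega)) (hz : zEnergy W ≠ ⊤)
    (hb : eLpNorm W ⊤ (volume.restrict Omega) ≤ ENNReal.ofReal (1 / ε))
    (hWM : ∫ p in Omega, W p ^ 2 ≤ M) : R ε δ W ≤ 0 := by
  have hκ := le_one_sub_div_rpow hε hε1 hδ1
  rw [R]
  set κ := (1 - δ) / ε ^ (3 / 2 : ℝ) with hκd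
  have hκ0 : 0 < κ := lt_of_lt_of_le (by positivity) hκ
  by_cases hE : energy 1 W + energy 2 W = ⊤
  · rw [hE, EReal.coe_ennreal_top, EReal.coe_mul_top_of_pos hκ0, EReal.sub_top]
    exact bot_le
  obtain ⟨hE1, hE2⟩ := ENNReal.add_ne_top.1 hE
  rw [← EReal.coe_ennreal_toReal hz, ← EReal.coe_ennreal_toReal hE, ← EReal.coe_mul,
    ← EReal.coe_mul, ← EReal.coe_sub, ← EReal.coe_sub, ← EReal.coe_zero, EReal.coe_le_coe_iff,
    sub_sub, sub_nonpos]
  -- near-minimal weak derivatives stand in for the infima; their excess `η` tends to zero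
  refine le_of_forall_pos_le_add fun η' hη' => ?_
  set η := η' / ((1 - δ) + 2 * κ) with hη
  have hden : 0 < (1 - δ) + 2 * κ := by linarith
  have hη0 : 0 < η := by positivity
  obtain ⟨g₀, h₀, b₀⟩ := exists_isWeakDeriv_zEnergy_le hz hη0
  obtain ⟨g₁, h₁, b₁⟩ := exists_isWeakDeriv_energy_le hE1 hη0
  obtain ⟨g₂, h₂, b₂⟩ := exists_isWeakDeriv_energy_le hE2 hη0
  have t₀ : zEnergy W + ENNReal.ofReal η ≠ ⊤ := ENNReal.add_ne_top.2 ⟨hz, ENNReal.ofReal_ne_top⟩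
  have b := add_le_add b₁ b₂
  rw [add_add_add_comm, ← ENNReal.ofReal_add hη0.le hη0.le] at b
  have t : energy 1 W + energy 2 W + ENNReal.ofReal (η + η) ≠ ⊤ :=
    ENNReal.add_ne_top.2 ⟨hE, ENNReal.ofReal_ne_top⟩
  have key := inequality_of_isWeakDeriv hδ hM hε (hε1.trans (by norm_num)) hδM hκ hW hb h₀ h₁ h₂ hWM
    (ne_top_of_le_ne_top t₀ b₀) (ne_top_of_le_ne_top t b)
  have r₀ := ENNReal.toReal_mono t₀ b₀
  have r := ENNReal.toReal_mono t b
  rw [ENNReal.toReal_add hz ENNReal.ofReal_ne_top, ENNReal.toReal_ofReal hη0.le] at r₀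
  rw [ENNReal.toReal_add hE ENNReal.ofReal_ne_top, ENNReal.toReal_ofReal (by positivity)] at r
  have k₀ := mul_le_mul_of_nonneg_left r₀ (show 0 ≤ 1 - δ by linarith)
  have k := mul_le_mul_of_nonneg_left r hκ0.le
  have hη2 : η * ((1 - δ) + 2 * κ) = η' := div_mul_cancel₀ _ hden.ne'
  nlinarith

end StripPoincare

end

theorem proposition2p1 (M : ℝ) (hM : 0 < M) :
    ∃ δM : ℝ, 0 < δM ∧ ∃ εM : ℝ, 0 < εM ∧ εM < 1 ∧
      ∀ δ : ℝ, 0 < δ → δ < δM → ∀ ε : ℝ, 0 < ε → ε < εM →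
        ∀ W : StripPoincare.Cyl → ℝ,
          MeasureTheory.MemLp W 2 (MeasureTheory.volume.restrict StripPoincare.Omega) →
          (∃ g : StripPoincare.Cyl → ℝ, StripPoincare.IsWeakDeriv 0 W g ∧
            MeasureTheory.MemLp (fun p => Real.sqrt (p.1 * (1 - p.1)) * g p) 2
              (MeasureTheory.volume.restrict StripPoincare.Omega)) →
          MeasureTheory.eLpNorm W ⊤ (MeasureTheory.volume.restrict StripPoincare.Omega)
            ≤ ENNReal.ofReal (1 / ε) →
          (∫ p in StripPoincare.Omega, W p ^ 2) ≤ M →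
          StripPoincare.R ε δ W ≤ 0 := by
  have hI : 0 ≤ ∫ z in Ioo (0 : ℝ) 1, StripPoincare.logWeight z ^ 3 :=
    setIntegral_nonneg measurableSet_Ioo fun z hz =>
      pow_nonneg (StripPoincare.logWeight_nonneg hz.1 hz.2) 3
  set K := 10000 * (1 + M + (4 * M + 4 * (1 + 16 * M ^ 2) +
      4096 * ((∫ z in Ioo 0 1, StripPoincare.logWeight z ^ 3) * (4 * M) ^ 3))) with hK
  have hC : 0 ≤ 4 * M + 4 * (1 + 16 * M ^ 2) +
      4096 * ((∫ z in Ioo 0 1, StripPoincare.logWeight z ^ 3) * (4 * M) ^ 3) := by positivity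
  have hK1 : 10000 ≤ K := by linarith
  have hK0 : 0 < K := by linarith
  refine ⟨1 / K, by positivity, 1 / 10 ^ 10, by norm_num, by norm_num,
    fun δ hδ hδM ε hε hεM W hW ⟨g, hg, hg2⟩ hb hWM => ?_⟩
  have h1 : δ * K ≤ 1 := ((lt_div_iff₀ hK0).1 hδM).le
  exact StripPoincare.R_nonpos hδ (by nlinarith) hM hε hεM h1 hW
    (StripPoincare.zEnergy_ne_top hg hg2) hb hWM
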